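/- Let $0<\alpha\le 1$, $0<\beta<1$ and $F\subseteq\mathbb R$. For $x\le y$ and $\delta>0$ put $\gamma^\alpha_\delta(F,x,y)=\inf\sum_{i<n}\frac{(t_{i+1}-t_i)^\alpha}{\Gamma(\alpha+1)}\,\Theta(F,[t_i,t_{i+1}])$, the infimum over all subdivisions $x=t_0\le\dots\le t_n=y$ of mesh at most $\delta$, where $\Theta(F,I)=1$ if $F\cap I\ne\emptyset$ and $0$ otherwise; let $\gamma^\alpha(F,x,y)=\lim_{\delta\to0}\gamma^\alpha_\delta(F,x,y)$, and let $S=S_F^\alpha$ be the staircase function, $S(x)=\gamma^\alpha(F,0,x)$ for $x\ge0$ and $S(x)=-\gamma^\alpha(F,x,0)$ for $x<0$. Assume that $F$ is $\alpha$-perfect (that is, $\gamma^\alpha(F,x,y)<\infty$ for all $x\le y$, and $F$ is exactly the set of points around which $S$ is not constant on any open interval) and that $S(t)\to\infty$ as $t\to\infty$. Let $d_F^\alpha t$ denote integration with respect to the Lebesgue–Stieltjes measure of $S$, and let $D_F^\alpha f(x)=\lim_{y\to x,\,y\in F}\frac{f(y)-f(x)}{S(y)-S(x)}$ for $x\in F$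 and $D_F^\alpha f(x)=0$ for $x\notin F$. Put $$\Gamma_F^\alpha(x)=\int_0^\infty e^{-S(t)}S(t)^{x-1}\,d_F^\alpha t,\qquad E_F^\alpha(z)=\sum_{j=0}^\infty\frac{z^j}{\Gamma_F^\alpha(\beta j+1)},$$ $$D^\beta p(t)=\frac1{\Gamma_F^\alpha(1-\beta)}\int_0^t (S(t)-S(\tau))^{-\beta}\,D_F^\alpha p(\tau)\,d_F^\alpha\tau .$$ A price path is a function $p$ that is continuous on $[0,\infty)$, locally constant on $(0,\infty)\setminus F$, and $F^\alpha$-differentiable at every $t\in F$ with $S(t)>0$. A price path $p$ solves an equation in $D^\beta p$ if for every $t$ with $S(t)>0$ the integral in $D^\beta p(t)$ converges absolutely and the equation holds at $t$. Let $d_0,d_1,s_0,s_1\in\mathbb R$ with $d_1+s_1\ne0$. Then the series $E_F^\alpha(z)$ converges absolutely for every $z\in\mathbb R$, and the following hold. 1. For all $\lambda,p_0\in\mathbb R$, the equation $D^\beta p+\lambda(d_1+s_1)p=\lambda(d_0+s_0)$ has exactly one price path with $p(0)=p_0$ as a solution (on $[0,\infty)$), namely $$p(t)=p_0\,E_F^\alpha\big(-\lambda(d_1+s_1)S(t)^\beta\big)+\frac{d_0+s_0}{d_1+s_1}\Big(1-E_F^\alpha\big(-\lambda(d_1+s_1)S(t)^\beta\big)\Big),\qquad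 t\ge0.$$ 2. For all $d_2,s_2\in\mathbb R$ with $d_2+s_2\ne0$ and all $p_0\in\mathbb R$, the equation with expectations $D^\beta p-\frac{d_1+s_1}{d_2+s_2}p=-\frac{d_0+s_0}{d_2+s_2}$ has exactly one price path with $p(0)=p_0$ as a solution (on $[0,\infty)$), namely $$p(t)=p_0\,E_F^\alpha\Big(\frac{d_1+s_1}{d_2+s_2}S(t)^\beta\Big)+\frac{d_0+s_0}{d_1+s_1}\Big(1-E_F^\alpha\Big(\frac{d_1+s_1}{d_2+s_2}S(t)^\beta\Big)\Big),\qquad t\ge0.$$ -/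

import Mathlib

open MeasureTheory Filter Topology Set
open scoped ENNReal

noncomputable section

namespace FractalCalculus

open Classical in
/-- The flag function `Θ(F, [x, y])`. -/
def flag (F : Set ℝ) (x y : ℝ) : ℝ≥0∞ := if (F ∩ Icc x y).Nonempty then 1 else 0

/-- `t 0, …, t n` is a subdivision of `[x, y]` of mesh at most `δ`
(the values of `t` beyond `n` are irrelevant). -/
structure IsSubdivision (x y δ : ℝ) (n : ℕ) (t : ℕ → ℝ) : Prop where
  mono : Monotone t
  left : t 0 = x
  right : t n = y
  mesh : ∀ i < n, t (i + 1) - t i ≤ δ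

/-- The sum `σ^α[F, P] = ∑ (t (i+1) - t i)^α / Γ(α + 1) * Θ(F, [t i, t (i+1)])`. -/
def subdivisionSum (F : Set ℝ) (α : ℝ) (n : ℕ) (t : ℕ → ℝ) : ℝ≥0∞ :=
  ∑ i ∈ Finset.range n,
    ENNReal.ofReal ((t (i + 1) - t i) ^ α / Real.Gamma (α + 1)) * flag F (t i) (t (i + 1))

/-- The coarse-grained mass `γ_δ^α(F, x, y)`, for `x ≤ y`. -/
def coarseMass (F : Set ℝ) (α δ x y : ℝ) : ℝ≥0∞ :=
  ⨅ (n : ℕ) (t : ℕ → ℝ) (_ : IsSubdivision x y δ n t), subdivisionSum F α n t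

/-- The mass function `γ^α(F, x, y) = lim_{δ → 0} γ_δ^α(F, x, y)`, for `x ≤ y`. The coarse-grained
mass grows as `δ` decreases, so the limit is a supremum; it may be infinite. -/
def mass (F : Set ℝ) (α x y : ℝ) : ℝ≥0∞ := ⨆ (δ : ℝ) (_ : 0 < δ), coarseMass F α δ x y

/-- The integral staircase function `S_F^α` with base point `0`. -/
def staircase (F : Set ℝ) (α x : ℝ) : ℝ :=
  if 0 ≤ x then (mass F α 0 x).toReal else -(mass F α x 0).toReal

/-- `Sch(f)`: the points of change of `f`, i.e. the points around which `f` is not constant on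
any open interval. -/
def pointsOfChange (f : ℝ → ℝ) : Set ℝ :=
  {x | ∀ c d : ℝ, c < x → x < d → ∃ y ∈ Ioo c d, ∃ z ∈ Ioo c d, f y ≠ f z}

/-- `F` is `α`-perfect: the staircase function is finite everywhere and `F` is exactly its set of
points of change. -/
structure IsAlphaPerfect (F : Set ℝ) (α : ℝ) : Prop where
  mass_ne_top : ∀ x y : ℝ, x ≤ y → mass F α x y ≠ ∞
  pointsOfChange_eq : pointsOfChange (staircase F α) = F

/-- The difference quotient of `f` at `x` with respect to the staircase function. -/
def fractalSlope (F : Set ℝ) (α : ℝ) (f : ℝ → ℝ) (x y : ℝ) : ℝ :=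
  (f y - f x) / (staircase F α y - staircase F α x)

/-- `f` is `F^α`-differentiable at `x ∈ F`: the difference quotient has a limit through the points
of `F`. -/
def FractalDifferentiableAt (F : Set ℝ) (α : ℝ) (f : ℝ → ℝ) (x : ℝ) : Prop :=
  ∃ l : ℝ, Tendsto (fractalSlope F α f x) (𝓝[F \ {x}] x) (𝓝 l)

open Classical in
/-- The `F^α`-derivative `D_F^α f`: the limit of the difference quotients through `F` at the points
of `F`, and `0` off `F`. -/
def fractalDeriv (F : Set ℝ) (α : ℝ) (f : ℝ → ℝ) (x : ℝ) : ℝ :=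
  if x ∈ F then limUnder (𝓝[F \ {x}] x) (fractalSlope F α f x) else 0

open Classical in
/-- The measure `d_F^α t`: the Lebesgue-Stieltjes measure of the staircase function. (If `F` has
finite mass on bounded intervals, then the staircase function is monotone.) -/
def fractalMeasure (F : Set ℝ) (α : ℝ) : Measure ℝ :=
  if h : Monotone (staircase F α) then h.stieltjesFunction.measure else 0

/-- The fractal Gamma function `∫_0^∞ e^{-S(t)} S(t)^{x-1} d_F^α t`, where `S = S_F^α` and the
argument `x` is a value of the staircase coordinate. -/
def fractalGamma (F : Set ℝ) (α x : ℝ) : ℝ :=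
  ∫ t in Ioi (0 : ℝ),
    Real.exp (-staircase F α t) * staircase F α t ^ (x - 1) ∂(fractalMeasure F α)

/-- The general term `z^j / Γ_F^α(ηj + a)` of the fractal Mittag-Leffler series, at the value `z` of
the staircase coordinate. -/
def mittagLefflerTerm (F : Set ℝ) (α η a z : ℝ) (j : ℕ) : ℝ :=
  z ^ j / fractalGamma F α (η * j + a)

/-- The fractal Mittag-Leffler function `∑_j z^j / Γ_F^α(ηj + a)`. -/
def fractalMittagLeffler (F : Set ℝ) (α η a z : ℝ) : ℝ :=
  ∑' j : ℕ, mittagLefflerTerm F α η a z j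

/-- The integrand `(S(x) - S(t))^{-β} D_F^α f(t)` of the Caputo fractal derivative. -/
def caputoIntegrand (F : Set ℝ) (α β : ℝ) (f : ℝ → ℝ) (x t : ℝ) : ℝ :=
  (staircase F α x - staircase F α t) ^ (-β) * fractalDeriv F α f t

/-- The integral that defines the Caputo fractal derivative of `f` at `x` converges. -/
def CaputoExistsAt (F : Set ℝ) (α β : ℝ) (f : ℝ → ℝ) (x : ℝ) : Prop :=
  IntegrableOn (caputoIntegrand F α β f x) (Ioc 0 x) (fractalMeasure F α)

/-- The Caputo fractal derivative of order `β ∈ (0, 1)` with base point `0`: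
`1 / Γ_F^α(1 - β) * ∫_0^x (S(x) - S(t))^{-β} D_F^α f(t) d_F^α t`. -/
def caputoDeriv (F : Set ℝ) (α β : ℝ) (f : ℝ → ℝ) (x : ℝ) : ℝ :=
  1 / fractalGamma F α (1 - β) *
    ∫ t in Ioc 0 x, caputoIntegrand F α β f x t ∂(fractalMeasure F α)

/-- The regularity that a price path has: it is continuous on `[0, ∞)`, it changes only on `F`, and
it is `F^α`-differentiable at the points of `F` after the start. (As in the classical case, the
derivative of a solution of an equation of order `β < 1` is singular at the start.) -/
structure IsPricePath (F : Set ℝ) (α : ℝ) (p : ℝ → ℝ) : Prop where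
  continuousOn : ContinuousOn p (Ici 0)
  locallyConstant : ∀ t : ℝ, 0 < t → t ∉ F → ∀ᶠ u in 𝓝 t, p u = p t
  differentiable : ∀ t ∈ F, 0 < staircase F α t → FractalDifferentiableAt F α p t

/-- `p` is a price path, with initial value `p₀`, that solves `D^β p + a p = c` at all times at
which the staircase function has left `0`. -/
structure SolvesCaputo (F : Set ℝ) (α β a c p₀ : ℝ) (p : ℝ → ℝ) : Prop where
  path : IsPricePath F α p
  initial : p 0 = p₀
  exists_deriv : ∀ t : ℝ, 0 < staircase F α t → CaputoExistsAt F α β p t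
  equation : ∀ t : ℝ, 0 < staircase F α t → caputoDeriv F α β p t + a * p t = c

end FractalCalculus

end

/-! The staircase `S` is continuous and monotone, vanishes at `0` and tends to infinity, so it can
serve as a clock. Its right inverse, `lastTime S`, takes values in `F` only, because `S` increases
immediately after a last time. It also pushes Lebesgue measure on `(0, ∞)` forward to the Stieltjes
measure of `S` (`map_lastTime_Ioi`). Hence the fractal Gamma function is the classical one, and
fractal integrals become Lebesgue integrals in `s = S t`.

A price path is constant on the gaps of `F`, so it factors as `p = h ∘ S` with `h = p ∘ lastTime S`
continuous. Off the countably many jumps of `lastTime S`, the derivative of `h` is the fractal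
derivative of `p`. The equation thus becomes a classical Caputo equation for `h`, and subtracting
the equilibrium `k` makes it homogeneous, with right-hand side `b * h`, `b = -a`.

Uniqueness: an Abel integral of order `β` inverts the Caputo derivative (`integral_integral_abel`)
and gives a Volterra equation. Iterating that equation leaves a remainder bounded by a term of a
convergent Mittag-Leffler series (`abs_sub_partialSum_le`). Existence: the Mittag-Leffler series is
differentiated and integrated term by term with Beta integrals (`caputo_relaxation`), and the result
is pulled back along `S`. -/

noncomputable section

namespace FractalCalculus

variable {F : Set ℝ} {α : ℝ}

/-! ### Additivity of the mass and continuity of the staircase -/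

/-- The largest term that an interval of length at most `δ` contributes to a subdivision sum. -/
def meshBound (α δ : ℝ) : ℝ≥0∞ := ENNReal.ofReal (δ ^ α / Real.Gamma (α + 1))

theorem term_le_meshBound (hα : 0 < α) {x y δ : ℝ} (hxy : x ≤ y) (hδ : y - x ≤ δ) (f : ℝ≥0∞)
    (hf : f ≤ 1) : ENNReal.ofReal ((y - x) ^ α / Real.Gamma (α + 1)) * f ≤ meshBound α δ := by
  calc _ ≤ ENNReal.ofReal ((y - x) ^ α / Real.Gamma (α + 1)) * 1 := by gcongr
    _ ≤ _ := by
      rw [mul_one]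
      refine ENNReal.ofReal_le_ofReal ?_
      have : 0 < Real.Gamma (α + 1) := Real.Gamma_pos_of_pos (by linarith)
      have := Real.rpow_le_rpow (sub_nonneg.2 hxy) hδ hα.le
      gcongr

theorem tendsto_meshBound (hα : 0 < α) : Tendsto (meshBound α) (𝓝[>] 0) (𝓝 0) := by
  have h : Tendsto (fun δ : ℝ => δ ^ α / Real.Gamma (α + 1)) (𝓝 0) (𝓝 0) := by
    have := ((Real.continuousAt_rpow_const 0 α (Or.inr hα.le)).tendsto).div_const
      (Real.Gamma (α + 1))
    simpa [Real.zero_rpow hα.ne'] using this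
  have := (ENNReal.tendsto_ofReal h).mono_left (nhdsWithin_le_nhds (s := Ioi (0 : ℝ)))
  rw [ENNReal.ofReal_zero] at this
  exact this

theorem flag_le_one (F : Set ℝ) (x y : ℝ) : flag F x y ≤ 1 := by
  unfold flag; split_ifs <;> simp

theorem coarseMass_le_subdivisionSum {x y δ : ℝ} {n : ℕ} {t : ℕ → ℝ}
    (ht : IsSubdivision x y δ n t) : coarseMass F α δ x y ≤ subdivisionSum F α n t :=
  iInf_le_of_le n <| iInf_le_of_le t <| iInf_le_of_le ht le_rfl

theorem coarseMass_anti {δ δ' : ℝ} (h : δ ≤ δ') (x y : ℝ) :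
    coarseMass F α δ' x y ≤ coarseMass F α δ x y :=
  le_iInf fun _ => le_iInf fun _ => le_iInf fun ht =>
    coarseMass_le_subdivisionSum
      ⟨ht.mono, ht.left, ht.right, fun i hi => (ht.mesh i hi).trans h⟩

theorem coarseMass_le_mass {δ : ℝ} (h : 0 < δ) (x y : ℝ) : coarseMass F α δ x y ≤ mass F α x y :=
  le_iSup₂_of_le δ h le_rfl

theorem coarseMass_le_meshBound (hα : 0 < α) {x y δ : ℝ} (hxy : x ≤ y) (h : y - x ≤ δ) :
    coarseMass F α δ x y ≤ meshBound α (y - x) := by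
  let t : ℕ → ℝ := fun i => if i = 0 then x else y
  have ht : IsSubdivision x y δ 1 t := by
    refine ⟨monotone_nat_of_le_succ fun n => ?_, by simp [t], by simp [t], fun i hi => ?_⟩
    · rcases n with _ | n <;> simp [t, hxy]
    · obtain rfl : i = 0 := by omega
      simpa [t] using h
  refine (coarseMass_le_subdivisionSum ht).trans ?_
  simp only [subdivisionSum, Finset.sum_range_one]
  exact term_le_meshBound hα (by simp [t, hxy]) (by simp [t]) _ (flag_le_one _ _ _)

theorem coarseMass_add_ge (x y z δ : ℝ) :
    coarseMass F α δ x z ≤ coarseMass F α δ x y + coarseMass F α δ y z := by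
  unfold coarseMass
  simp only [ENNReal.iInf_add, ENNReal.add_iInf]
  refine le_iInf fun m => le_iInf fun u => le_iInf fun hu => le_iInf fun n => le_iInf fun t =>
    le_iInf fun ht => ?_
  let v : ℕ → ℝ := fun i => if i ≤ n then t i else u (i - n)
  have hv1 : ∀ i ≤ n, v i = t i := fun i hi => by simp [v, hi]
  have hv2 : ∀ i, v (n + i) = u i := fun i => by
    rcases i with _ | i
    · simp [v, ht.right, hu.left]
    · simp [v]
  have hv : IsSubdivision x z δ (n + m) v := by
    refine ⟨monotone_nat_of_le_succ fun i => ?_, by rw [hv1 0 (Nat.zero_le n), ht.left],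
      by rw [hv2, hu.right], fun i hi => ?_⟩
    · rcases lt_or_ge i n with h | h
      · rw [hv1 i h.le, hv1 (i + 1) h]; exact ht.mono (Nat.le_succ i)
      · obtain ⟨j, rfl⟩ := Nat.exists_eq_add_of_le h
        rw [hv2, add_assoc, hv2]; exact hu.mono (Nat.le_succ j)
    · rcases lt_or_ge i n with h | h
      · rw [hv1 i h.le, hv1 (i + 1) h]; exact ht.mesh i h
      · obtain ⟨j, rfl⟩ := Nat.exists_eq_add_of_le h
        rw [hv2, add_assoc, hv2]; exact hu.mesh j (by omega)
  refine (coarseMass_le_subdivisionSum hv).trans ?_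
  rw [subdivisionSum, Finset.sum_range_add, subdivisionSum, subdivisionSum]
  refine add_le_add (le_of_eq (Finset.sum_congr rfl fun i hi => ?_))
    (le_of_eq (Finset.sum_congr rfl fun i hi => ?_))
  · have hi := Finset.mem_range.1 hi
    rw [hv1 i hi.le, hv1 (i + 1) hi]
  · rw [add_assoc, hv2, hv2]

/-- Cutting a subdivision at `y` changes only an interval with `y` in its interior. There is at most
one, and its two pieces cost at most `meshBound α δ` each. This error vanishes with `δ`, so the mass
is additive in the limit. -/
theorem coarseMass_add_le (hα : 0 < α) {x y z δ : ℝ} (hxy : x ≤ y) (hyz : y ≤ z) :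
    coarseMass F α δ x y + coarseMass F α δ y z ≤
      coarseMass F α δ x z + (meshBound α δ + meshBound α δ) := by
  conv_rhs => unfold coarseMass
  simp only [ENNReal.iInf_add]
  refine le_iInf fun n => le_iInf fun t => le_iInf fun ht => ?_
  have hmono : ∀ i, t i ≤ t (i + 1) := fun i => ht.mono (Nat.le_succ i)
  let u : ℕ → ℝ := fun i => min (t i) y
  -- Truncation at `y` keeps all `n` steps; the superfluous ones have length zero and contribute `0
  -- ^ α = 0`.
  let v : ℕ → ℝ := fun i => max (t i) y
  have hu : IsSubdivision x y δ n u := by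
    refine ⟨fun i j h => min_le_min_right _ (ht.mono h), by simp [u, ht.left, hxy],
      by simp [u, ht.right, hyz], fun i hi => ?_⟩
    have := ht.mesh i hi; have := hmono i
    simp only [u]; rcases min_cases (t i) y with h | h <;>
      rcases min_cases (t (i + 1)) y with h' | h' <;> linarith
  have hv : IsSubdivision y z δ n v := by
    refine ⟨fun i j h => max_le_max_right _ (ht.mono h), by simp [v, ht.left, hxy],
      by simp [v, ht.right, hyz], fun i hi => ?_⟩
    have := ht.mesh i hi; have := hmono i
    simp only [v]; rcases max_cases (t i) y with h | h <;>
      rcases max_cases (t (i + 1)) y with h' | h' <;> linarith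
  refine (add_le_add (coarseMass_le_subdivisionSum hu)
    (coarseMass_le_subdivisionSum hv)).trans ?_
  simp only [subdivisionSum]
  rw [← Finset.sum_add_distrib]
  set K := meshBound α δ + meshBound α δ with hK
  have hsplit : ∀ i ∈ Finset.range n,
      ENNReal.ofReal ((u (i + 1) - u i) ^ α / Real.Gamma (α + 1)) * flag F (u i) (u (i + 1)) +
      ENNReal.ofReal ((v (i + 1) - v i) ^ α / Real.Gamma (α + 1)) * flag F (v i) (v (i + 1)) ≤
      ENNReal.ofReal ((t (i + 1) - t i) ^ α / Real.Gamma (α + 1)) * flag F (t i) (t (i + 1)) +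
      if t i < y ∧ y < t (i + 1) then K else 0 := by
    intro i hi
    have hi := Finset.mem_range.1 hi
    have hz : (0 : ℝ) ^ α = 0 := Real.zero_rpow hα.ne'
    have h1 := hmono i
    by_cases h : t i < y ∧ y < t (i + 1)
    · rw [if_pos h]
      refine le_add_left (add_le_add ?_ ?_)
      · exact term_le_meshBound hα (hu.mono (Nat.le_succ i)) (hu.mesh i hi) _ (flag_le_one _ _ _)
      · exact term_le_meshBound hα (hv.mono (Nat.le_succ i)) (hv.mesh i hi) _ (flag_le_one _ _ _)
    · rw [if_neg h, add_zero]
      rcases le_or_gt y (t i) with h2 | h2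
      · have : y ≤ t (i + 1) := h2.trans h1
        simp [u, v, h2, this, hz]
      · have h3 : t (i + 1) ≤ y := by
          by_contra h4; exact h ⟨h2, not_le.1 h4⟩
        simp [u, v, h2.le, h3, hz]
  refine (Finset.sum_le_sum hsplit).trans ?_
  rw [Finset.sum_add_distrib]
  refine add_le_add le_rfl ?_
  rw [← Finset.sum_filter, Finset.sum_const]
  have hcard : (Finset.filter (fun i => t i < y ∧ y < t (i + 1)) (Finset.range n)).card ≤ 1 := by
    refine Finset.card_le_one.2 fun i hi j hj => ?_
    simp only [Finset.mem_filter] at hi hj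
    rcases lt_trichotomy i j with h | h | h
    · have : t (i + 1) ≤ t j := ht.mono h
      linarith [hi.2.2, hj.2.1]
    · exact h
    · have : t (j + 1) ≤ t i := ht.mono h
      linarith [hj.2.2, hi.2.1]
  calc _ ≤ 1 • K := by gcongr
    _ = K := one_smul _ _

theorem mass_eq_iSup_pos (x y : ℝ) : mass F α x y = ⨆ δ : Ioi (0 : ℝ), coarseMass F α δ x y := by
  rw [mass, iSup_subtype']; rfl

theorem mass_add (hα : 0 < α) {x y z : ℝ} (hxy : x ≤ y) (hyz : y ≤ z) :
    mass F α x z = mass F α x y + mass F α y z := by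
  apply le_antisymm
  · refine iSup₂_le fun δ hδ => (coarseMass_add_ge x y z δ).trans ?_
    exact add_le_add (coarseMass_le_mass hδ _ _) (coarseMass_le_mass hδ _ _)
  · rw [mass_eq_iSup_pos x y, mass_eq_iSup_pos y z, ENNReal.iSup_add_iSup]
    · refine iSup_le fun ⟨δ, hδ⟩ => ?_
      have hδ : 0 < δ := hδ
      have hlim : Tendsto (fun ε => mass F α x z + (meshBound α ε + meshBound α ε)) (𝓝[>] 0)
          (𝓝 (mass F α x z)) := by
        simpa using (((tendsto_meshBound hα).add (tendsto_meshBound hα)).const_add (mass F α x z))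
      refine ge_of_tendsto hlim ?_
      filter_upwards [Ioc_mem_nhdsGT hδ] with ε hε
      refine (add_le_add (coarseMass_anti hε.2 _ _) (coarseMass_anti hε.2 _ _)).trans ?_
      exact (coarseMass_add_le hα hxy hyz).trans
        (add_le_add (coarseMass_le_mass hε.1 _ _) le_rfl)
    · rintro ⟨i, hi⟩ ⟨j, hj⟩
      exact ⟨⟨min i j, mem_Ioi.2 (lt_min hi hj)⟩, add_le_add (coarseMass_anti (min_le_left _ _) _ _)
        (coarseMass_anti (min_le_right _ _) _ _)⟩

theorem mass_self (F : Set ℝ) (α x : ℝ) : mass F α x x = 0 := by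
  refine le_antisymm (iSup₂_le fun δ hδ => ?_) zero_le
  refine (coarseMass_le_subdivisionSum (n := 0) (t := fun _ => x)
    ⟨monotone_const, rfl, rfl, fun i hi => by omega⟩).trans (by simp [subdivisionSum])

theorem staircase_zero (F : Set ℝ) (α : ℝ) : staircase F α 0 = 0 := by
  simp [staircase, mass_self]

theorem staircase_sub (hα : 0 < α) (hfin : ∀ x y : ℝ, x ≤ y → mass F α x y ≠ ∞) {x y : ℝ}
    (hxy : x ≤ y) : staircase F α y - staircase F α x = (mass F α x y).toReal := by
  unfold staircase
  split_ifs with h1 h2 h2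
  · rw [mass_add hα h2 hxy, ENNReal.toReal_add (hfin _ _ h2) (hfin _ _ hxy)]; ring
  · have h2 := (not_le.1 h2).le
    rw [mass_add hα h2 h1, ENNReal.toReal_add (hfin _ _ h2) (hfin _ _ h1)]; ring
  · linarith
  · have h1 := (not_le.1 h1).le
    have h2 := (not_le.1 h2).le
    rw [mass_add hα hxy h1, ENNReal.toReal_add (hfin _ _ hxy) (hfin _ _ h1)]; ring

theorem staircase_monotone (hα : 0 < α) (hfin : ∀ x y : ℝ, x ≤ y → mass F α x y ≠ ∞) :
    Monotone (staircase F α) := fun x y h => by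
  have := staircase_sub hα hfin h
  have : 0 ≤ (mass F α x y).toReal := ENNReal.toReal_nonneg
  linarith

theorem exists_coarseMass_gt {x y : ℝ} (hfin : mass F α x y ≠ ∞) {ε : ℝ≥0∞} (hε : ε ≠ 0) :
    ∃ δ > 0, mass F α x y ≤ coarseMass F α δ x y + ε := by
  rcases eq_or_ne (mass F α x y) 0 with h | h
  · exact ⟨1, one_pos, by simp [h]⟩
  · have : mass F α x y - ε < mass F α x y := ENNReal.sub_lt_self hfin h hε
    conv_rhs at this => rw [mass]
    simp only [lt_iSup_iff] at this
    obtain ⟨δ, hδ, h⟩ := this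
    exact ⟨δ, hδ, tsub_le_iff_right.1 h.le⟩

/-- At a scale `δ` where the coarse mass of `[x, x + 1]` is within `ε` of the mass, subadditivity
bounds it by the coarse mass of `[x, x + h]` plus the mass of the rest. A single interval makes the
former less than `ε` for small `h`; cancelling the finite mass of the rest leaves `ε + ε`. -/
theorem mass_right_small (hα : 0 < α) (hfin : ∀ x y : ℝ, x ≤ y → mass F α x y ≠ ∞) (x : ℝ)
    {ε : ℝ≥0∞} (hε : ε ≠ 0) : ∃ h > 0, mass F α x (x + h) ≤ ε + ε := by
  obtain ⟨δ, hδ, h1⟩ := exists_coarseMass_gt (hfin x (x + 1) (by linarith)) hε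
  have hb : ∀ᶠ h in 𝓝[>] (0 : ℝ), meshBound α h < ε :=
    (tendsto_meshBound hα).eventually_lt_const (pos_iff_ne_zero.2 hε)
  obtain ⟨h, hh, hh'⟩ := (hb.and (Ioc_mem_nhdsGT (lt_min hδ one_pos))).exists
  have hδ' := hh'.2.trans (min_le_left _ _)
  have h11 := hh'.2.trans (min_le_right _ _)
  have hpos : 0 < h := hh'.1
  refine ⟨h, hpos, ?_⟩
  have hadd := mass_add (F := F) hα (show x ≤ x + h by linarith) (show x + h ≤ x + 1 by linarith)
  have hne := hfin (x + h) (x + 1) (by linarith)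
  rw [← ENNReal.add_le_add_iff_right hne, ← hadd]
  refine h1.trans ?_
  have h2 : coarseMass F α δ x (x + h) ≤ ε :=
    (coarseMass_le_meshBound hα (by linarith) (by linarith)).trans
      (by simpa using hh.le)
  calc _ ≤ coarseMass F α δ x (x + h) + coarseMass F α δ (x + h) (x + 1) + ε := by
        gcongr; exact coarseMass_add_ge _ _ _ _
    _ ≤ ε + mass F α (x + h) (x + 1) + ε := by
        gcongr; exact coarseMass_le_mass hδ _ _
    _ = _ := by ring

theorem mass_left_small (hα : 0 < α) (hfin : ∀ x y : ℝ, x ≤ y → mass F α x y ≠ ∞) (x : ℝ)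
    {ε : ℝ≥0∞} (hε : ε ≠ 0) : ∃ h > 0, mass F α (x - h) x ≤ ε + ε := by
  obtain ⟨δ, hδ, h1⟩ := exists_coarseMass_gt (hfin (x - 1) x (by linarith)) hε
  have hb : ∀ᶠ h in 𝓝[>] (0 : ℝ), meshBound α h < ε :=
    (tendsto_meshBound hα).eventually_lt_const (pos_iff_ne_zero.2 hε)
  obtain ⟨h, hh, hh'⟩ := (hb.and (Ioc_mem_nhdsGT (lt_min hδ one_pos))).exists
  have hδ' := hh'.2.trans (min_le_left _ _)
  have h11 := hh'.2.trans (min_le_right _ _)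
  have hpos : 0 < h := hh'.1
  refine ⟨h, hpos, ?_⟩
  have hadd := mass_add (F := F) hα (show x - 1 ≤ x - h by linarith) (show x - h ≤ x by linarith)
  have hne := hfin (x - 1) (x - h) (by linarith)
  rw [← ENNReal.add_le_add_iff_left hne, ← hadd]
  refine h1.trans ?_
  have h2 : coarseMass F α δ (x - h) x ≤ ε :=
    (coarseMass_le_meshBound hα (by linarith) (by linarith)).trans
      (by simpa using hh.le)
  calc _ ≤ coarseMass F α δ (x - 1) (x - h) + coarseMass F α δ (x - h) x + ε := by
        gcongr; exact coarseMass_add_ge _ _ _ _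
    _ ≤ mass F α (x - 1) (x - h) + ε + ε := by
        gcongr; exact coarseMass_le_mass hδ _ _
    _ = _ := by ring

theorem staircase_continuous (hα : 0 < α) (hfin : ∀ x y : ℝ, x ≤ y → mass F α x y ≠ ∞) :
    Continuous (staircase F α) := by
  have hmono := staircase_monotone hα hfin
  refine continuous_iff_continuousAt.2 fun x => Metric.continuousAt_iff'.2 fun ε hε => ?_
  have hε4 : ENNReal.ofReal (ε / 4) ≠ 0 := by simpa using hε
  have hsum : ENNReal.ofReal (ε / 4) + ENNReal.ofReal (ε / 4) = ENNReal.ofReal (ε / 2) := by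
    rw [← ENNReal.ofReal_add (by positivity) (by positivity)]; congr 1; ring
  obtain ⟨h, hh, h1⟩ := mass_right_small hα hfin x hε4
  obtain ⟨k, hk, h2⟩ := mass_left_small hα hfin x hε4
  rw [hsum] at h1 h2
  have h1 := ENNReal.toReal_le_of_le_ofReal (by positivity) h1
  have h2 := ENNReal.toReal_le_of_le_ofReal (by positivity) h2
  rw [← staircase_sub hα hfin (by linarith)] at h1 h2
  filter_upwards [Ioo_mem_nhds (show x - k < x by linarith) (show x < x + h by linarith)] with y hy
  have := hmono hy.1.le
  have := hmono hy.2.le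
  rw [Real.dist_eq, abs_lt]
  constructor <;> linarith

/-! ### Clocks and their right inverse -/

/-- A continuous monotone function that vanishes at `0` and tends to infinity. -/
structure IsClock (S : ℝ → ℝ) : Prop where
  mono : Monotone S
  cont : Continuous S
  zero : S 0 = 0
  top : Tendsto S atTop atTop

/-- The last time at which `S` has the value `max s 0`. -/
def lastTime (S : ℝ → ℝ) (s : ℝ) : ℝ := sSup {t | S t ≤ max s 0}

namespace IsClock

variable {S : ℝ → ℝ} (hS : IsClock S)

include hS

theorem apply_lastTime_le (s : ℝ) :
    S (lastTime S s) ≤ max s 0 ∧ ∀ t, S t ≤ max s 0 → t ≤ lastTime S s := by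
  have hne : {t | S t ≤ max s 0}.Nonempty := ⟨0, by simp [hS.zero]⟩
  have hbdd : BddAbove {t | S t ≤ max s 0} := by
    obtain ⟨b, hb⟩ := (hS.top.eventually_gt_atTop (max s 0)).exists
    exact ⟨b, fun t ht => le_of_not_gt fun h => (hb.trans_le (hS.mono h.le)).not_ge ht⟩
  exact ⟨(isClosed_le hS.cont continuous_const).csSup_mem hne hbdd, fun t ht => le_csSup hbdd ht⟩

theorem le_lastTime_iff {s t : ℝ} : t ≤ lastTime S s ↔ S t ≤ max s 0 :=
  ⟨fun h => (hS.mono h).trans (hS.apply_lastTime_le s).1, (hS.apply_lastTime_le s).2 t⟩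

theorem lastTime_lt_iff {s t : ℝ} : lastTime S s < t ↔ max s 0 < S t := by
  rw [← not_le, hS.le_lastTime_iff, not_le]

theorem exists_nonneg_eq {s : ℝ} (hs : 0 ≤ s) : ∃ t, 0 ≤ t ∧ S t = s := by
  obtain ⟨b, hb, hb0⟩ := ((hS.top.eventually_ge_atTop s).and (eventually_ge_atTop 0)).exists
  obtain ⟨t, ht, h⟩ := intermediate_value_Icc hb0 hS.cont.continuousOn
    (show s ∈ Icc (S 0) (S b) from ⟨by rwa [hS.zero], hb⟩)
  exact ⟨t, ht.1, h⟩

theorem apply_lastTime (s : ℝ) : S (lastTime S s) = max s 0 := by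
  obtain ⟨t, -, ht⟩ := hS.exists_nonneg_eq (le_max_right s 0)
  exact le_antisymm (hS.apply_lastTime_le s).1 (ht ▸ hS.mono ((hS.apply_lastTime_le s).2 t ht.le))

theorem apply_lastTime_of_nonneg {s : ℝ} (hs : 0 ≤ s) : S (lastTime S s) = s := by
  rw [hS.apply_lastTime, max_eq_left hs]

theorem lastTime_nonneg (s : ℝ) : 0 ≤ lastTime S s := by
  rw [hS.le_lastTime_iff, hS.zero]; exact le_max_right _ _

theorem lastTime_pos {s : ℝ} (hs : 0 < s) : 0 < lastTime S s := by
  refine (hS.lastTime_nonneg s).lt_of_ne fun h => ?_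
  have := hS.apply_lastTime_of_nonneg hs.le
  rw [← h, hS.zero] at this
  exact hs.ne this

theorem nonneg {t : ℝ} (ht : 0 ≤ t) : 0 ≤ S t := hS.zero ▸ hS.mono ht

theorem pos_of_apply_pos {t : ℝ} (ht : 0 < S t) : 0 < t := by
  by_contra h
  have := hS.mono (not_lt.1 h)
  rw [hS.zero] at this
  linarith

theorem lastTime_mono : Monotone (lastTime S) := fun s s' h => by
  rw [hS.le_lastTime_iff, hS.apply_lastTime]
  exact max_le_max_right _ h

theorem le_lastTime_apply {t : ℝ} : t ≤ lastTime S (S t) :=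
  hS.le_lastTime_iff.2 (le_max_left _ _)

theorem lastTime_mem_pointsOfChange (s : ℝ) : lastTime S s ∈ pointsOfChange S := by
  intro c d hc hd
  obtain ⟨z, hz, hz'⟩ := exists_between hd
  refine ⟨lastTime S s, ⟨hc, hd⟩, z, ⟨hc.trans hz, hz'⟩, ?_⟩
  rw [hS.apply_lastTime]
  exact (hS.lastTime_lt_iff.1 hz).ne

theorem notMem_pointsOfChange {t u x : ℝ} (h : S t = S u) (htx : t < x) (hxu : x < u) :
    x ∉ pointsOfChange S := by
  intro hx
  obtain ⟨y, hy, z, hz, hne⟩ := hx t u htx hxu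
  have h1 := hS.mono hy.1.le
  have h2 := hS.mono hy.2.le
  have h3 := hS.mono hz.1.le
  have h4 := hS.mono hz.2.le
  exact hne (by linarith)

/-- Near `x` the clock takes a value other than `S x`. The last time of any level strictly between
is a point of change between `x` and that place. This makes the limit in the fractal derivative
unique. -/
theorem nhdsWithin_neBot {x : ℝ} (hx : x ∈ pointsOfChange S) (hpos : 0 < S x) :
    (𝓝[pointsOfChange S \ {x}] x).NeBot := by
  refine mem_closure_iff_nhdsWithin_neBot.1 (mem_closure_iff_nhds.2 fun U hU => ?_)
  obtain ⟨c, d, ⟨hc, hd⟩, hcd⟩ := mem_nhds_iff_exists_Ioo_subset.1 hU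
  obtain ⟨y, hy, z, hz, hne⟩ := hx (max c 0) d (max_lt hc (hS.pos_of_apply_pos hpos)) hd
  obtain ⟨w, hw, hwne⟩ : ∃ w ∈ Ioo (max c 0) d, S w ≠ S x := by
    by_cases h : S y = S x
    · exact ⟨z, hz, fun h' => hne (h.trans h'.symm)⟩
    · exact ⟨y, hy, h⟩
  obtain ⟨hw0, hwd⟩ := hw
  obtain ⟨hwc, hw0⟩ := max_lt_iff.1 hw0
  have hw0 := hS.nonneg hw0.le
  rcases lt_or_gt_of_ne hwne with h | h
  · obtain ⟨s, h1, h2⟩ := exists_between h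
    have hs := hS.apply_lastTime_of_nonneg (hw0.trans h1.le)
    have hlt : lastTime S s < x :=
      hS.lastTime_lt_iff.2 (by rwa [max_eq_left (hw0.trans h1.le)])
    have hwl : w ≤ lastTime S s := hS.le_lastTime_iff.2 (h1.le.trans (le_max_left _ _))
    exact ⟨lastTime S s, hcd ⟨hwc.trans_le hwl, hlt.trans hd⟩,
      hS.lastTime_mem_pointsOfChange s, hlt.ne⟩
  · obtain ⟨s, h1, h2⟩ := exists_between h
    have hs := hpos.trans h1
    have hlt : lastTime S s < w := hS.lastTime_lt_iff.2 (by rwa [max_eq_left hs.le])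
    have hxl : x < lastTime S s := by
      refine (hS.le_lastTime_iff.2 (h1.le.trans (le_max_left _ _))).lt_of_ne fun h => ?_
      have := hS.apply_lastTime_of_nonneg hs.le
      rw [← h] at this
      exact h1.ne this
    exact ⟨lastTime S s, hcd ⟨hc.trans hxl, hlt.trans hwd⟩,
      hS.lastTime_mem_pointsOfChange s, hxl.ne'⟩

/-- If `S` returns to the value `S x` on one side, the stretch between is flat and contains no point
of change. So the denominators of fractal slopes are eventually nonzero. -/
theorem eventually_apply_ne (x : ℝ) : ∀ᶠ y in 𝓝[pointsOfChange S \ {x}] x, S y ≠ S x := by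
  obtain ⟨d, hd, hd'⟩ : ∃ d > x, ∀ y ∈ pointsOfChange S, x < y → y < d → S y ≠ S x := by
    by_cases h : ∃ d > x, S d = S x
    · obtain ⟨d, hd, h⟩ := h
      exact ⟨d, hd, fun y hy h1 h2 _ => hS.notMem_pointsOfChange h.symm h1 h2 hy⟩
    · push Not at h
      exact ⟨x + 1, by linarith, fun y _ h1 _ => h y h1⟩
  obtain ⟨c, hc, hc'⟩ : ∃ c < x, ∀ y ∈ pointsOfChange S, c < y → y < x → S y ≠ S x := by
    by_cases h : ∃ c < x, S c = S x
    · obtain ⟨c, hc, h⟩ := h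
      exact ⟨c, hc, fun y hy h1 h2 _ => hS.notMem_pointsOfChange h h1 h2 hy⟩
    · push Not at h
      exact ⟨x - 1, by linarith, fun y _ _ h1 => h y h1⟩
  filter_upwards [self_mem_nhdsWithin, mem_nhdsWithin_of_mem_nhds (Ioo_mem_nhds hc hd)]
    with y hy hy'
  rcases lt_or_gt_of_ne (show y ≠ x from hy.2) with h | h
  · exact hc' y hy.1 hy'.1 h
  · exact hd' y hy.1 h hy'.2

/-- Since `S` inverts `lastTime S` on the nonnegative levels, the set lies between the open and the
closed interval with endpoints `max (S a) 0` and `S b`. -/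
theorem volume_preimage_Ioc (a b : ℝ) :
    volume (Ioi 0 ∩ lastTime S ⁻¹' Ioc a b) = ENNReal.ofReal (S b - max (S a) 0) := by
  apply le_antisymm
  · rw [← Real.volume_Icc]
    refine measure_mono fun s hs => ?_
    obtain ⟨hs0, hs1, hs2⟩ := hs
    have hs0 : 0 < s := hs0
    have h := hS.apply_lastTime_of_nonneg hs0.le
    refine ⟨max_le ?_ hs0.le, ?_⟩
    · rw [← h]; exact hS.mono hs1.le
    · rw [← h]; exact hS.mono hs2
  · rw [← Real.volume_Ioo]
    refine measure_mono fun s hs => ?_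
    obtain ⟨hs1, hs2⟩ := hs
    obtain ⟨hs1, hs0⟩ := max_lt_iff.1 hs1
    have h := hS.apply_lastTime_of_nonneg hs0.le
    refine ⟨hs0, ?_, ?_⟩
    · by_contra hc
      exact (h ▸ hS.mono (not_lt.1 hc)).not_gt hs1
    · exact (hS.lastTime_lt_iff.2 (by rwa [max_eq_left hs0.le])).le

theorem measure_Ioc (a b : ℝ) :
    hS.mono.stieltjesFunction.measure (Ioc a b) = ENNReal.ofReal (S b - S a) := by
  rw [StieltjesFunction.measure_Ioc, hS.mono.stieltjesFunction_eq, hS.mono.stieltjesFunction_eq,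
    hS.cont.continuousWithinAt.rightLim_eq, hS.cont.continuousWithinAt.rightLim_eq]

theorem measurable_lastTime : Measurable (lastTime S) := hS.lastTime_mono.measurable

theorem map_lastTime_Ioi : (volume.restrict (Ioi 0)).map (lastTime S) =
    hS.mono.stieltjesFunction.measure.restrict (Ioi 0) := by
  symm
  refine Measure.ext_of_Ioc _ _ fun a b _ => ?_
  rw [Measure.map_apply hS.measurable_lastTime measurableSet_Ioc,
    Measure.restrict_apply (hS.measurable_lastTime measurableSet_Ioc),
    Measure.restrict_apply measurableSet_Ioc, Ioc_inter_Ioi, hS.measure_Ioc, inter_comm,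
    hS.volume_preimage_Ioc, hS.mono.map_max, hS.zero]

theorem map_lastTime_Ioc (x : ℝ) : (volume.restrict (Ioc 0 (S x))).map (lastTime S) =
    hS.mono.stieltjesFunction.measure.restrict (Ioc 0 x) := by
  have h := congrArg (fun μ => μ.restrict (Ioc 0 x)) hS.map_lastTime_Ioi
  rw [Measure.restrict_restrict measurableSet_Ioc, inter_eq_left.2 Ioc_subset_Ioi_self,
    Measure.restrict_map hS.measurable_lastTime measurableSet_Ioc,
    Measure.restrict_restrict (hS.measurable_lastTime measurableSet_Ioc)] at h
  rw [← h]
  congr 1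
  -- The two sets can differ only at the level `S x`, whose last time may lie beyond `x`.
  refine Measure.restrict_congr_set ?_
  have h1 : Ioo 0 (S x) ⊆ lastTime S ⁻¹' Ioc 0 x ∩ Ioi 0 := fun s hs =>
    ⟨⟨hS.lastTime_pos hs.1, (hS.lastTime_lt_iff.2 (by rw [max_eq_left hs.1.le]; exact hs.2)).le⟩,
      hs.1⟩
  have h2 : lastTime S ⁻¹' Ioc 0 x ∩ Ioi 0 ⊆ Ioc 0 (S x) := fun s ⟨hs, hs0⟩ =>
    ⟨hs0, (hS.apply_lastTime_of_nonneg (le_of_lt hs0)) ▸ hS.mono hs.2⟩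
  refine Filter.EventuallyLE.antisymm ?_ h2.eventuallyLE
  exact (Ioo_ae_eq_Ioc (μ := volume) (a := 0) (b := S x)).symm.le.trans h1.eventuallyLE

end IsClock

/-! ### Fractal integrals in the staircase coordinate -/

theorem IsAlphaPerfect.isClock (hα : 0 < α) (hF : IsAlphaPerfect F α)
    (hS : Tendsto (staircase F α) atTop atTop) : IsClock (staircase F α) :=
  ⟨staircase_monotone hα hF.mass_ne_top, staircase_continuous hα hF.mass_ne_top,
    staircase_zero F α, hS⟩

theorem fractalMeasure_eq (hS : IsClock (staircase F α)) :
    fractalMeasure F α = hS.mono.stieltjesFunction.measure := dif_pos hS.mono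

theorem integral_fractalMeasure_Ioc (hS : IsClock (staircase F α)) {x : ℝ} {f : ℝ → ℝ}
    (hf : AEStronglyMeasurable f ((fractalMeasure F α).restrict (Ioc 0 x))) :
    ∫ t in Ioc 0 x, f t ∂(fractalMeasure F α) =
      ∫ s in Ioc 0 (staircase F α x), f (lastTime (staircase F α) s) := by
  rw [fractalMeasure_eq hS, ← hS.map_lastTime_Ioc x] at hf ⊢
  exact integral_map hS.measurable_lastTime.aemeasurable hf

theorem integrableOn_fractalMeasure_Ioc (hS : IsClock (staircase F α)) {x : ℝ}
    {f : ℝ → ℝ} (hf : AEStronglyMeasurable f ((fractalMeasure F α).restrict (Ioc 0 x))) :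
    IntegrableOn f (Ioc 0 x) (fractalMeasure F α) ↔
      IntegrableOn (fun s => f (lastTime (staircase F α) s)) (Ioc 0 (staircase F α x)) := by
  unfold IntegrableOn
  rw [fractalMeasure_eq hS, ← hS.map_lastTime_Ioc x] at hf ⊢
  exact integrable_map_measure hf hS.measurable_lastTime.aemeasurable

/-- The measure is a pushforward under `lastTime`, so only last times matter; in particular it is
carried by `F`. -/
theorem ae_fractalMeasure_Ioc (hS : IsClock (staircase F α)) {x : ℝ} {p : ℝ → Prop}
    (hp : MeasurableSet {t | p t})
    (h : ∀ s ∈ Ioc 0 (staircase F α x), p (lastTime (staircase F α) s)) :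
    ∀ᵐ t ∂((fractalMeasure F α).restrict (Ioc 0 x)), p t := by
  rw [fractalMeasure_eq hS, ← hS.map_lastTime_Ioc x,
    ae_map_iff hS.measurable_lastTime.aemeasurable hp]
  exact (ae_restrict_iff' measurableSet_Ioc).2 (Eventually.of_forall h)

theorem fractalGamma_eq (hS : IsClock (staircase F α)) {x : ℝ} (hx : 0 < x) :
    fractalGamma F α x = Real.Gamma x := by
  have hm := hS.mono.measurable
  rw [fractalGamma, fractalMeasure_eq hS, ← hS.map_lastTime_Ioi,
    integral_map hS.measurable_lastTime.aemeasurable (by fun_prop), Real.Gamma_eq_integral hx]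
  refine setIntegral_congr_fun measurableSet_Ioi fun s hs => ?_
  simp only [hS.apply_lastTime_of_nonneg (le_of_lt hs)]

/-! ### Beta integrals and Abel kernels -/

theorem integral_beta {u v : ℝ} (hu : 0 < u) (hv : 0 < v) :
    ∫ x in (0 : ℝ)..1, x ^ (u - 1) * (1 - x) ^ (v - 1) =
      Real.Gamma u * Real.Gamma v / Real.Gamma (u + v) := by
  have h1 := Complex.Gamma_mul_Gamma_eq_betaIntegral (s := u) (t := v) (by simpa) (by simpa)
  have h2 : Complex.betaIntegral u v =
      ((∫ x in (0 : ℝ)..1, x ^ (u - 1) * (1 - x) ^ (v - 1) : ℝ) : ℂ) := by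
    rw [Complex.betaIntegral, ← intervalIntegral.integral_ofReal]
    refine intervalIntegral.integral_congr fun x hx => ?_
    rw [uIcc_of_le zero_le_one] at hx
    have h1 : (0 : ℝ) ≤ 1 - x := by linarith [hx.2]
    rw [Complex.ofReal_mul, Complex.ofReal_cpow hx.1, Complex.ofReal_cpow h1]
    push_cast; rfl
  rw [h2, ← Complex.ofReal_add, Complex.Gamma_ofReal, Complex.Gamma_ofReal, Complex.Gamma_ofReal,
    ← Complex.ofReal_mul, ← Complex.ofReal_mul] at h1
  have h3 := Complex.ofReal_injective h1
  have : Real.Gamma (u + v) ≠ 0 := (Real.Gamma_pos_of_pos (by linarith)).ne'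
  rw [h3]; field_simp

theorem abel_kernel_comp {u v a b : ℝ} (hab : a < b) {x : ℝ} (hx : x ∈ Icc (0 : ℝ) 1) :
    (b - (a + (b - a) * x)) ^ (u - 1) * (a + (b - a) * x - a) ^ (v - 1) =
      (b - a) ^ (u + v - 2) * (x ^ (v - 1) * (1 - x) ^ (u - 1)) := by
  have hba : 0 < b - a := sub_pos.2 hab
  have e1 : b - (a + (b - a) * x) = (b - a) * (1 - x) := by ring
  have e2 : a + (b - a) * x - a = (b - a) * x := by ring
  rw [e1, e2, Real.mul_rpow hba.le (by linarith [hx.2]), Real.mul_rpow hba.le hx.1,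
    show u + v - 2 = (u - 1) + (v - 1) by ring, Real.rpow_add hba]
  ring

theorem integral_abel_kernel {u v a b : ℝ} (hu : 0 < u) (hv : 0 < v) (hab : a < b) :
    ∫ t in a..b, (b - t) ^ (u - 1) * (t - a) ^ (v - 1) =
      (b - a) ^ (u + v - 1) * (Real.Gamma u * Real.Gamma v / Real.Gamma (u + v)) := by
  have hba : 0 < b - a := sub_pos.2 hab
  have h := intervalIntegral.mul_integral_comp_add_mul
    (f := fun t : ℝ => (b - t) ^ (u - 1) * (t - a) ^ (v - 1)) (a := 0) (b := 1) (b - a) a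
  have e : a + (b - a) * 1 = b := by ring
  rw [mul_zero, add_zero, e] at h
  rw [← h, intervalIntegral.integral_congr (g := fun x =>
    (b - a) ^ (u + v - 2) * (x ^ (v - 1) * (1 - x) ^ (u - 1))) fun x hx =>
      abel_kernel_comp hab (by rwa [uIcc_of_le zero_le_one] at hx),
    intervalIntegral.integral_const_mul, integral_beta hv hu, ← mul_assoc,
    show u + v - 1 = 1 + (u + v - 2) by ring, Real.rpow_add hba, Real.rpow_one, add_comm v u]
  ring

theorem intervalIntegrable_abel_kernel {u v a b : ℝ} (hu : 0 < u) (hv : 0 < v) (hab : a < b) :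
    IntervalIntegrable (fun t : ℝ => (b - t) ^ (u - 1) * (t - a) ^ (v - 1)) volume a b := by
  -- The integral of a non-integrable function is `0` by convention, whereas the closed formula is
  -- positive.
  by_contra h
  have h1 := integral_abel_kernel hu hv hab
  rw [intervalIntegral.integral_undef h] at h1
  have := Real.rpow_pos_of_pos (sub_pos.2 hab) (u + v - 1)
  have := Real.Gamma_pos_of_pos hu
  have := Real.Gamma_pos_of_pos hv
  have := Real.Gamma_pos_of_pos (add_pos hu hv)
  exact h1.not_lt (by positivity)

/-! ### Convergence of the Mittag-Leffler series -/

/-- In Euler's integral keep only `t > R`, where `t ^ x ≥ R ^ x`. As `R` is free, Gamma outgrows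
every geometric sequence. -/
theorem rpow_mul_exp_le_Gamma {R x : ℝ} (hR : 0 < R) (hx : 0 ≤ x) :
    R ^ x * Real.exp (-R) ≤ Real.Gamma (x + 1) := by
  rw [Real.Gamma_eq_integral (by linarith), add_sub_cancel_right, ← integral_exp_neg_Ioi,
    ← integral_const_mul]
  have hint : IntegrableOn (fun t : ℝ => Real.exp (-t) * t ^ x) (Ioi 0) := by
    simpa using Real.GammaIntegral_convergent (s := x + 1) (by linarith)
  calc ∫ t in Ioi R, R ^ x * Real.exp (-t) ≤ ∫ t in Ioi R, Real.exp (-t) * t ^ x := by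
        refine setIntegral_mono_on ((exp_neg_integrableOn_Ioi R one_pos |>.congr_fun
          (fun t _ => by simp) measurableSet_Ioi).const_mul _)
          (hint.mono_set (Ioi_subset_Ioi hR.le)) measurableSet_Ioi fun t ht => ?_
        rw [mul_comm]
        gcongr
        exact le_of_lt ht
    _ ≤ ∫ t in Ioi 0, Real.exp (-t) * t ^ x := by
        refine setIntegral_mono_set hint ?_ (Ioi_subset_Ioi hR.le).eventuallyLE
        refine (ae_restrict_iff' measurableSet_Ioi).2 (Eventually.of_forall fun t ht => ?_)
        have : (0 : ℝ) < t := ht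
        simp only [Pi.zero_apply]; positivity

theorem summable_mittagLeffler {β : ℝ} (hβ : 0 < β) (z : ℝ) :
    Summable fun j : ℕ => z ^ j / Real.Gamma (β * j + 1) := by
  -- This `R` makes the `j`-th term at most `exp R * (1 / 2) ^ j`.
  obtain ⟨R, hR, hzR⟩ : ∃ R : ℝ, 0 < R ∧ R ^ β = 2 * (|z| + 1) := by
    refine ⟨(2 * (|z| + 1)) ^ (1 / β), by positivity, ?_⟩
    rw [← Real.rpow_mul (by positivity), one_div_mul_cancel hβ.ne', Real.rpow_one]
  refine Summable.of_norm_bounded (summable_geometric_two.mul_left (Real.exp R)) fun j => ?_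
  have h1 := rpow_mul_exp_le_Gamma hR (show 0 ≤ β * j by positivity)
  rw [Real.rpow_mul hR.le, Real.rpow_natCast, hzR] at h1
  have hG : 0 < Real.Gamma (β * j + 1) := Real.Gamma_pos_of_pos (by positivity)
  rw [norm_div, norm_pow, Real.norm_eq_abs, Real.norm_eq_abs, abs_of_pos hG, div_le_iff₀ hG]
  have h2 : Real.exp R * (1 / 2) ^ j * ((2 * (|z| + 1)) ^ j * Real.exp (-R)) = (|z| + 1) ^ j := by
    rw [Real.exp_neg, mul_pow, one_div, inv_pow]
    have := Real.exp_pos R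
    field_simp
  calc |z| ^ j ≤ (|z| + 1) ^ j := by gcongr; linarith
    _ = _ := h2.symm
    _ ≤ _ := by gcongr

theorem summable_mittagLeffler_deriv {β : ℝ} (hβ : 0 < β) (z : ℝ) :
    Summable fun j : ℕ => z ^ j / Real.Gamma (β * j + β) := by
  rcases eq_or_ne z 0 with rfl | hz
  · refine summable_of_ne_finset_zero (s := {0}) fun j hj => ?_
    have : j ≠ 0 := by simpa using hj
    simp [this]
  -- By the functional equation of Gamma, these coefficients are those of the Mittag-Leffler series,
  -- shifted, times `β * (j + 1)`. The factor `j + 1 ≤ 2 ^ (j + 1)` is absorbed by taking the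
  -- argument `2 * |z|`.
  have h := ((summable_nat_add_iff 1).2 (summable_mittagLeffler hβ (2 * |z|))).mul_left (β / |z|)
  have hz : 0 < |z| := abs_pos.2 hz
  refine Summable.of_norm_bounded h fun j => ?_
  have hG : 0 < Real.Gamma (β * (j + 1) + 1) := Real.Gamma_pos_of_pos (by positivity)
  have hG' : 0 < Real.Gamma (β * j + β) := Real.Gamma_pos_of_pos (by positivity)
  have e : Real.Gamma (β * (j + 1) + 1) = β * (j + 1) * Real.Gamma (β * j + β) := by
    rw [Real.Gamma_add_one (by positivity), mul_add, mul_one]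
  have h2 : ((j : ℝ) + 1) ≤ 2 ^ (j + 1) := by
    have := (Nat.lt_two_pow_self (n := j + 1)).le
    exact_mod_cast this
  rw [norm_div, norm_pow, Real.norm_eq_abs, Real.norm_eq_abs, abs_of_pos hG']
  push_cast
  rw [e, mul_pow]
  calc |z| ^ j / Real.Gamma (β * j + β)
      = |z| ^ j * (j + 1) / ((j + 1) * Real.Gamma (β * j + β)) := by field_simp
    _ ≤ |z| ^ j * 2 ^ (j + 1) / ((j + 1) * Real.Gamma (β * j + β)) := by gcongr
    _ = _ := by rw [pow_succ |z|]; field_simp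

theorem pow_rpow_mul {β b v s : ℝ} (hs : 0 < s) (j : ℕ) :
    (b * s ^ β) ^ j * s ^ (v - 1) = b ^ j * (s - 0) ^ (β * j + v - 1) := by
  rw [sub_zero, mul_pow, ← Real.rpow_natCast (s ^ β), ← Real.rpow_mul hs.le, mul_assoc,
    ← Real.rpow_add hs, ← add_sub_assoc]

theorem intervalIntegrable_abel_pow {β u v T : ℝ} (hβ : 0 < β) (hu : 0 < u) (hv : 0 < v)
    (hT : 0 < T) (b : ℝ) (j : ℕ) :
    IntervalIntegrable (fun s : ℝ => (T - s) ^ (u - 1) * ((b * s ^ β) ^ j * s ^ (v - 1)))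
      volume 0 T := by
  refine ((intervalIntegrable_abel_kernel hu (show 0 < β * j + v by positivity) hT).const_mul
    (b ^ j)).congr fun s hs => ?_
  rw [uIoc_of_le hT.le] at hs
  rw [pow_rpow_mul hs.1]
  ring

theorem integral_abel_pow {β u v T : ℝ} (hβ : 0 < β) (hu : 0 < u) (hv : 0 < v)
    (hT : 0 < T) (b : ℝ) (j : ℕ) :
    ∫ s in 0..T, (T - s) ^ (u - 1) * ((b * s ^ β) ^ j * s ^ (v - 1)) =
      T ^ (u + v - 1) * (b * T ^ β) ^ j *
        (Real.Gamma u * Real.Gamma (β * j + v) / Real.Gamma (β * j + (u + v))) := by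
  have h : ∫ s in 0..T, (T - s) ^ (u - 1) * ((b * s ^ β) ^ j * s ^ (v - 1)) =
      ∫ s in 0..T, b ^ j * ((T - s) ^ (u - 1) * (s - 0) ^ (β * j + v - 1)) := by
    refine intervalIntegral.integral_congr_ae (Eventually.of_forall fun s hs => ?_)
    rw [uIoc_of_le hT.le] at hs
    rw [pow_rpow_mul hs.1]
    ring
  have e := pow_rpow_mul (β := β) (b := b) (v := u + v) hT j
  rw [sub_zero] at e
  rw [h, intervalIntegral.integral_const_mul,
    integral_abel_kernel hu (show 0 < β * j + v by positivity) hT, sub_zero,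
    mul_comm (T ^ (u + v - 1)), e, show u + (β * j + v) = β * j + (u + v) by ring]
  ring

/-! ### Uniqueness for the Volterra equation -/

/-- A solution of the Abel-Volterra equation, compared with the partial sums of the Mittag-Leffler
series. -/
theorem abs_sub_partialSum_le {β b M T : ℝ} (hβ : 0 < β) {h : ℝ → ℝ} (hc : ContinuousOn h (Icc 0 T))
    (hM : ∀ t ∈ Icc 0 T, |h t| ≤ M)
    (heq : ∀ t ∈ Ioc 0 T, h t = h 0 + b / Real.Gamma β * ∫ s in 0..t, (t - s) ^ (β - 1) * h s)
    (n : ℕ) : ∀ t ∈ Icc 0 T,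
      |h t - ∑ j ∈ Finset.range n, h 0 * ((b * t ^ β) ^ j / Real.Gamma (β * j + 1))| ≤
        M * ((|b| * t ^ β) ^ n / Real.Gamma (β * n + 1)) := by
  have hGβ : 0 < Real.Gamma β := Real.Gamma_pos_of_pos hβ
  have hG : ∀ j : ℕ, 0 < Real.Gamma (β * j + 1) := fun j => Real.Gamma_pos_of_pos (by positivity)
  induction n with
  | zero => intro t ht; simpa using hM t ht
  | succ n ih =>
    intro t ht
    rcases ht.1.eq_or_lt with rfl | ht0
    · rw [Finset.sum_range_succ']
      simp [Real.zero_rpow hβ.ne']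
    have hker := intervalIntegrable_abel_kernel hβ one_pos ht0
    simp only [sub_self, Real.rpow_zero, mul_one] at hker
    have hpw : ∀ (c : ℝ) (j : ℕ), IntervalIntegrable
        (fun s => (t - s) ^ (β - 1) * (c * s ^ β) ^ j) volume 0 t := fun c j => by
      simpa using intervalIntegrable_abel_pow hβ hβ one_pos ht0 c j
    -- The Volterra operator sends each Mittag-Leffler term to the next one.
    have hpi : ∀ (c : ℝ) (j : ℕ), c / Real.Gamma β * ∫ s in 0..t, (t - s) ^ (β - 1) *
        ((c * s ^ β) ^ j / Real.Gamma (β * j + 1)) =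
        (c * t ^ β) ^ (j + 1) / Real.Gamma (β * (j + 1 : ℕ) + 1) := fun c j => by
      have e := integral_abel_pow hβ hβ one_pos ht0 c j
      simp only [sub_self, Real.rpow_zero, mul_one, add_sub_cancel_right] at e
      have e2 : (β * (j + 1 : ℕ) + 1) = β * j + (β + 1) := by push_cast; ring
      have e3 : 0 < Real.Gamma (β * j + (β + 1)) := Real.Gamma_pos_of_pos (by positivity)
      have := hG j
      simp_rw [← mul_div_assoc]
      rw [intervalIntegral.integral_div, e, e2, pow_succ]
      field_simp
    have hhi : IntervalIntegrable (fun s => (t - s) ^ (β - 1) * h s) volume 0 t :=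
      hker.mul_continuousOn (hc.mono (by rw [uIcc_of_le ht0.le]; exact Icc_subset_Icc_right ht.2))
    have hPi : ∀ j ∈ Finset.range n, IntervalIntegrable (fun s => (t - s) ^ (β - 1) *
        (h 0 * ((b * s ^ β) ^ j / Real.Gamma (β * j + 1)))) volume 0 t := fun j _ => by
      refine ((hpw b j).const_mul (h 0 / Real.Gamma (β * j + 1))).congr fun s _ => ?_
      ring
    -- Hence each remainder is the Volterra operator applied to the previous remainder, and the same
    -- shift with `|b|` propagates the bound.
    have hkey : h t - ∑ j ∈ Finset.range (n + 1),
        h 0 * ((b * t ^ β) ^ j / Real.Gamma (β * j + 1)) =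
        b / Real.Gamma β * ∫ s in 0..t, (t - s) ^ (β - 1) *
          (h s - ∑ j ∈ Finset.range n, h 0 * ((b * s ^ β) ^ j / Real.Gamma (β * j + 1))) := by
      simp only [mul_sub, Finset.mul_sum]
      rw [intervalIntegral.integral_sub hhi (by
        simpa only [Finset.sum_fn] using IntervalIntegrable.sum _ hPi),
        intervalIntegral.integral_finsetSum hPi, mul_sub,
        Finset.sum_range_succ', heq t ⟨ht0, ht.2⟩, Finset.mul_sum]
      have : ∀ j ∈ Finset.range n, b / Real.Gamma β * ∫ s in 0..t, (t - s) ^ (β - 1) *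
          (h 0 * ((b * s ^ β) ^ j / Real.Gamma (β * j + 1))) =
          h 0 * ((b * t ^ β) ^ (j + 1) / Real.Gamma (β * (j + 1 : ℕ) + 1)) := fun j _ => by
        rw [← hpi b j, mul_left_comm (h 0), ← intervalIntegral.integral_const_mul (h 0)]
        congr 1
        exact intervalIntegral.integral_congr fun s _ => by ring
      rw [Finset.sum_congr rfl this]
      simp
      ring
    rw [hkey, abs_mul, abs_div, abs_of_pos hGβ, ← hpi |b| n, mul_left_comm,
      ← intervalIntegral.integral_const_mul]
    refine mul_le_mul_of_nonneg_left ?_ (by positivity)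
    rw [← Real.norm_eq_abs]
    refine intervalIntegral.norm_integral_le_of_norm_le ht0.le ?_ ?_
    · refine Eventually.of_forall fun s hs => ?_
      have hs' : s ∈ Icc 0 T := ⟨hs.1.le, hs.2.trans ht.2⟩
      have h1 : 0 ≤ (t - s) ^ (β - 1) := Real.rpow_nonneg (by linarith [hs.2]) _
      rw [norm_mul, Real.norm_eq_abs, abs_of_nonneg h1, mul_left_comm]
      exact mul_le_mul_of_nonneg_left (ih s hs') h1
    · refine ((hpw |b| n).const_mul (M / Real.Gamma (β * n + 1))).congr fun s _ => ?_
      ring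

/-- The function `s ↦ E_β(b s^β)`. -/
def relaxation (β b s : ℝ) : ℝ := ∑' j : ℕ, (b * s ^ β) ^ j / Real.Gamma (β * j + 1)

theorem eq_relaxation_of_volterra {β b T : ℝ} (hβ : 0 < β) (hT : 0 ≤ T) {h : ℝ → ℝ}
    (hc : ContinuousOn h (Icc 0 T))
    (heq : ∀ t ∈ Ioc 0 T, h t = h 0 + b / Real.Gamma β * ∫ s in 0..t, (t - s) ^ (β - 1) * h s) :
    h T = h 0 * relaxation β b T := by
  obtain ⟨M, hM⟩ := isCompact_Icc.exists_bound_of_continuousOn hc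
  have hle := fun n => abs_sub_partialSum_le hβ hc hM heq n T ⟨hT, le_rfl⟩
  have h1 := ((summable_mittagLeffler hβ (|b| * T ^ β)).tendsto_atTop_zero).const_mul M
  rw [mul_zero] at h1
  have h2 : Tendsto (fun n => ∑ j ∈ Finset.range n,
      h 0 * ((b * T ^ β) ^ j / Real.Gamma (β * j + 1))) atTop (𝓝 (h T)) := by
    refine tendsto_iff_norm_sub_tendsto_zero.2 (squeeze_zero (fun n => norm_nonneg _)
      (fun n => ?_) h1)
    rw [norm_sub_rev]
    exact hle n
  refine tendsto_nhds_unique h2 ?_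
  exact ((summable_mittagLeffler hβ (b * T ^ β)).hasSum.mul_left (h 0)).tendsto_sum_nat

/-! ### Abel inversion -/

/-- The kernel of the iterated Abel integral of a derivative. -/
def abelKernel (β T : ℝ) (f : ℝ → ℝ) (t s : ℝ) : ℝ :=
  (Ioi s).indicator (fun t => (T - t) ^ (β - 1) * (t - s) ^ (-β) * f s) t

theorem measurable_abelKernel {β T : ℝ} {f : ℝ → ℝ} (hf : Measurable f) :
    Measurable (Function.uncurry (abelKernel β T f)) := by
  have : Function.uncurry (abelKernel β T f) = {x : ℝ × ℝ | x.2 < x.1}.indicator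
      fun x => (T - x.1) ^ (β - 1) * (x.1 - x.2) ^ (-β) * f x.2 := by
    ext ⟨t, s⟩
    simp [abelKernel, indicator]
  rw [this]
  exact Measurable.indicator (by fun_prop) (measurableSet_lt measurable_snd measurable_fst)

theorem integrable_abelKernel {β T s : ℝ} (hβ : 0 < β) (hβ' : β < 1) (hs : 0 ≤ s) (hsT : s < T)
    (f : ℝ → ℝ) : IntegrableOn (fun t => abelKernel β T f t s) (Ioc 0 T) := by
  have h := (intervalIntegrable_iff_integrableOn_Ioc_of_le hsT.le).1
    (intervalIntegrable_abel_kernel hβ (sub_pos.2 hβ') hsT)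
  unfold abelKernel IntegrableOn
  rw [integrable_indicator_iff measurableSet_Ioi, IntegrableOn,
    Measure.restrict_restrict measurableSet_Ioi, inter_comm, Ioc_inter_Ioi, max_eq_right hs]
  refine (h.mul_const (f s)).congr (Eventually.of_forall fun t => ?_)
  simp only [show 1 - β - 1 = -β by ring]

/-- The orders `β` and `1 - β` add up to `1`, so the power of `T - s` in the Beta integral
disappears and `Gamma 1 = 1`. -/
theorem integral_abelKernel {β T s : ℝ} (hβ : 0 < β) (hβ' : β < 1) (hs : 0 ≤ s) (hsT : s < T)
    (f : ℝ → ℝ) : ∫ t in Ioc 0 T, abelKernel β T f t s =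
      Real.Gamma β * Real.Gamma (1 - β) * f s := by
  have h := integral_abel_kernel hβ (sub_pos.2 hβ') hsT
  rw [intervalIntegral.integral_of_le hsT.le] at h
  unfold abelKernel
  rw [setIntegral_indicator measurableSet_Ioi, Ioc_inter_Ioi, max_eq_right hs,
    integral_mul_const]
  simp only [show 1 - β - 1 = -β by ring] at h
  rw [h]
  simp

theorem norm_abelKernel {β T t s : ℝ} (ht : t ≤ T) (f : ℝ → ℝ) :
    ‖abelKernel β T f t s‖ = abelKernel β T (fun s => |f s|) t s := by
  unfold abelKernel
  by_cases h : t ∈ Ioi s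
  · have h1 : 0 ≤ (T - t) ^ (β - 1) := Real.rpow_nonneg (by linarith) _
    have h2 : 0 ≤ (t - s) ^ (-β) := Real.rpow_nonneg (by linarith [mem_Ioi.1 h]) _
    rw [indicator_of_mem h, indicator_of_mem h, norm_mul, Real.norm_eq_abs, Real.norm_eq_abs,
      abs_of_nonneg (mul_nonneg h1 h2)]
  · simp [indicator_of_notMem h]

theorem ae_lt_Ioc (T : ℝ) : ∀ᵐ s ∂(volume.restrict (Ioc 0 T)), 0 ≤ s ∧ s < T := by
  rw [← restrict_Ioo_eq_restrict_Ioc]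
  exact (ae_restrict_iff' measurableSet_Ioo).2 (Eventually.of_forall fun s hs => ⟨hs.1.le, hs.2⟩)

/-- By Tonelli: for `t ≤ T` the norm of the kernel is the kernel of `|f|`, whose integral in `t` is
a constant times `|f s|`. -/
theorem integrable_uncurry_abelKernel {β T : ℝ} (hβ : 0 < β) (hβ' : β < 1) {f : ℝ → ℝ}
    (hf : Measurable f) (hfi : IntegrableOn f (Ioc 0 T)) :
    Integrable (Function.uncurry (abelKernel β T f))
      ((volume.restrict (Ioc 0 T)).prod (volume.restrict (Ioc 0 T))) := by
  refine (integrable_prod_iff' (measurable_abelKernel hf).aestronglyMeasurable).2 ⟨?_, ?_⟩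
  · filter_upwards [ae_lt_Ioc T] with s hs using integrable_abelKernel hβ hβ' hs.1 hs.2 f
  · refine (hfi.norm.const_mul (Real.Gamma β * Real.Gamma (1 - β))).congr ?_
    filter_upwards [ae_lt_Ioc T] with s hs
    rw [Real.norm_eq_abs, ← integral_abelKernel hβ hβ' hs.1 hs.2 (fun s => |f s|)]
    exact setIntegral_congr_fun measurableSet_Ioc fun t ht => (norm_abelKernel ht.2 f).symm

/-- Abel inversion. -/
theorem integral_integral_abel {β T : ℝ} (hβ : 0 < β) (hβ' : β < 1) {f : ℝ → ℝ}
    (hf : Measurable f) (hfi : IntegrableOn f (Ioc 0 T)) :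
    ∫ t in Ioc 0 T, (T - t) ^ (β - 1) * ∫ s in Ioc 0 t, (t - s) ^ (-β) * f s =
      Real.Gamma β * Real.Gamma (1 - β) * ∫ s in Ioc 0 T, f s := by
  have h := integral_integral_swap (integrable_uncurry_abelKernel hβ hβ' hf hfi)
  have h1 : ∫ s in Ioc 0 T, ∫ t in Ioc 0 T, abelKernel β T f t s =
      ∫ s in Ioc 0 T, Real.Gamma β * Real.Gamma (1 - β) * f s := by
    refine integral_congr_ae ?_
    filter_upwards [ae_lt_Ioc T] with s hs using integral_abelKernel hβ hβ' hs.1 hs.2 f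
  rw [h1, integral_const_mul] at h
  rw [← h]
  refine setIntegral_congr_fun measurableSet_Ioc fun t ht => ?_
  have e : ∀ s, abelKernel β T f t s =
      (Iio t).indicator (fun s => (T - t) ^ (β - 1) * ((t - s) ^ (-β) * f s)) s := fun s => by
    simp [abelKernel, indicator, mul_assoc]
  simp only [e]
  rw [setIntegral_indicator measurableSet_Iio, ← integral_const_mul]
  have : Ioc 0 T ∩ Iio t = Ioo 0 t := by
    ext s
    simp only [mem_inter_iff, mem_Ioc, mem_Iio, mem_Ioo]
    exact ⟨fun h => ⟨h.1.1, h.2⟩, fun h => ⟨⟨h.1, h.2.le.trans ht.2⟩, h.2⟩⟩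
  rw [this, integral_Ioc_eq_integral_Ioo]

/-- On `(0, T)` the weight `(T - s) ^ (-β)` is at least `T ^ (-β)`. -/
theorem integrableOn_of_abel {β T : ℝ} (hβ : 0 < β) {f : ℝ → ℝ} (hf : Measurable f)
    (hfi : IntegrableOn (fun s => (T - s) ^ (-β) * f s) (Ioc 0 T)) : IntegrableOn f (Ioc 0 T) := by
  refine (hfi.norm.const_mul (T ^ β)).mono' hf.aestronglyMeasurable ?_
  filter_upwards [ae_lt_Ioc T] with s hs
  have hTs : 0 < T - s := sub_pos.2 hs.2
  rw [norm_mul, Real.norm_of_nonneg (Real.rpow_nonneg hTs.le _), Real.rpow_neg hTs.le,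
    ← mul_assoc, ← div_eq_mul_inv]
  refine le_mul_of_one_le_left (norm_nonneg _) ((one_le_div (Real.rpow_pos_of_pos hTs _)).2 ?_)
  exact Real.rpow_le_rpow hTs.le (by linarith [hs.1]) hβ.le

/-- The Caputo relaxation equation has only the Mittag-Leffler solution. -/
theorem eq_relaxation_of_caputo {β b : ℝ} (hβ : 0 < β) (hβ' : β < 1) {h : ℝ → ℝ} {C : Set ℝ}
    (hC : C.Countable) (hc : ContinuousOn h (Ici 0))
    (hd : ∀ s, 0 < s → s ∉ C → HasDerivAt h (deriv h s) s)
    (hi : ∀ T, 0 < T → IntegrableOn (fun s => (T - s) ^ (-β) * deriv h s) (Ioc 0 T))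
    (he : ∀ T, 0 < T → 1 / Real.Gamma (1 - β) * ∫ s in Ioc 0 T, (T - s) ^ (-β) * deriv h s =
      b * h T) {T : ℝ} (hT : 0 ≤ T) : h T = h 0 * relaxation β b T := by
  refine eq_relaxation_of_volterra hβ hT (hc.mono Icc_subset_Ici_self) fun t ht => ?_
  have hm := measurable_deriv h
  have hfi := integrableOn_of_abel hβ hm (hi t ht.1)
  have hG1 : 0 < Real.Gamma (1 - β) := Real.Gamma_pos_of_pos (by linarith)
  have hG2 : 0 < Real.Gamma β := Real.Gamma_pos_of_pos hβ
  -- Continuity of `h` and integrability of the derivative allow countably many exceptional points.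
  have hftc := integral_eq_of_hasDerivAt_off_countable_of_le h (deriv h) ht.1.le hC
    (hc.mono Icc_subset_Ici_self) (fun s hs => hd s hs.1.1 hs.2)
    ((intervalIntegrable_iff_integrableOn_Ioc_of_le ht.1.le).2 hfi)
  have habel := integral_integral_abel hβ hβ' hm hfi
  rw [intervalIntegral.integral_of_le ht.1.le] at hftc
  rw [hftc] at habel
  -- The equation replaces the inner Caputo integral by a multiple of `h r`.
  have e : ∫ r in Ioc 0 t, (t - r) ^ (β - 1) * ∫ s in Ioc 0 r, (r - s) ^ (-β) * deriv h s =
      ∫ r in Ioc 0 t, (Real.Gamma (1 - β) * b) * ((t - r) ^ (β - 1) * h r) := by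
    refine setIntegral_congr_fun measurableSet_Ioc fun r hr => ?_
    have := he r hr.1
    rw [one_div, inv_mul_eq_iff_eq_mul₀ hG1.ne'] at this
    rw [this]; ring
  rw [e, integral_const_mul, ← intervalIntegral.integral_of_le ht.1.le] at habel
  have h3 : b * ∫ s in 0..t, (t - s) ^ (β - 1) * h s = Real.Gamma β * (h t - h 0) := by
    apply mul_left_cancel₀ hG1.ne'
    linear_combination habel
  rw [div_mul_eq_mul_div, h3]
  field_simp
  ring

/-! ### The Mittag-Leffler function solves the relaxation equation -/

/-- The derivative of the Mittag-Leffler relaxation function. -/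
def relaxationDeriv (β b s : ℝ) : ℝ :=
  ∑' j : ℕ, (b * s ^ β) ^ j / Real.Gamma (β * j + β) * (b * s ^ (β - 1))

theorem relaxation_eq_one_add {β : ℝ} (hβ : 0 < β) (b s : ℝ) : relaxation β b s =
    1 + ∑' j : ℕ, (b * s ^ β) ^ (j + 1) / Real.Gamma (β * (j + 1 : ℕ) + 1) := by
  rw [relaxation, (summable_mittagLeffler hβ _).tsum_eq_zero_add]
  simp

theorem relaxation_zero {β : ℝ} (hβ : 0 < β) (b : ℝ) : relaxation β b 0 = 1 := by
  rw [relaxation_eq_one_add hβ]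
  simp [Real.zero_rpow hβ.ne']

theorem continuousOn_relaxation {β : ℝ} (hβ : 0 < β) (b : ℝ) :
    ContinuousOn (relaxation β b) (Ici 0) := by
  intro s hs
  have hs : 0 ≤ s := hs
  have h : ContinuousOn (relaxation β b) (Icc 0 (s + 1)) := by
    refine continuousOn_tsum (fun j => ?_) (summable_mittagLeffler hβ (|b| * (s + 1) ^ β))
      fun j t ht => ?_
    · have : Continuous fun t : ℝ => t ^ β := Real.continuous_rpow_const hβ.le
      fun_prop
    · have hG : 0 < Real.Gamma (β * j + 1) := Real.Gamma_pos_of_pos (by positivity)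
      have := ht.1
      rw [norm_div, norm_pow, norm_mul, Real.norm_eq_abs, Real.norm_of_nonneg hG.le,
        Real.norm_of_nonneg (Real.rpow_nonneg ht.1 _)]
      gcongr
      exact ht.2
  refine (h s ⟨hs, by linarith⟩).mono_of_mem_nhdsWithin ?_
  filter_upwards [self_mem_nhdsWithin, mem_nhdsWithin_of_mem_nhds (Iio_mem_nhds (lt_add_one s))]
    with t h1 h2 using ⟨h1, le_of_lt h2⟩

theorem hasDerivAt_relaxation {β b s : ℝ} (hβ : 0 < β) (hβ' : β < 1) (hs : 0 < s) :
    HasDerivAt (relaxation β b) (relaxationDeriv β b s) s := by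
  have hfun : relaxation β b = fun s =>
      1 + ∑' j : ℕ, (b * s ^ β) ^ (j + 1) / Real.Gamma (β * (j + 1 : ℕ) + 1) :=
    funext (relaxation_eq_one_add hβ b)
  rw [hfun]
  refine HasDerivAt.const_add 1 ?_
  -- The factor `t ^ (β - 1)` is singular at `0`; staying above `s / 2` gives a uniform summable
  -- bound on the derivatives.
  have hmem : s ∈ Ioo (s / 2) (s + 1) := ⟨by linarith, by linarith⟩
  refine hasDerivAt_tsum_of_isPreconnected (𝕜 := ℝ) (F := ℝ)
    (g := fun (j : ℕ) t => (b * t ^ β) ^ (j + 1) / Real.Gamma (β * (j + 1 : ℕ) + 1))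
    (g' := fun j t => (b * t ^ β) ^ j / Real.Gamma (β * j + β) * (b * t ^ (β - 1))) (t := Ioo (s / 2) (s + 1)) (y₀ := s)
    ((summable_mittagLeffler_deriv hβ (|b| * (s + 1) ^ β)).mul_right (|b| * (s / 2) ^ (β - 1)))
    isOpen_Ioo isPreconnected_Ioo (fun j t ht => ?_) (fun j t ht => ?_) hmem ?_ hmem
  · have ht0 : 0 < t := by linarith [ht.1]
    have hd := (((Real.hasDerivAt_rpow_const (p := β) (Or.inl ht0.ne')).const_mul b).pow
      (j + 1)).div_const (Real.Gamma (β * (j + 1 : ℕ) + 1))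
    refine hd.congr_deriv ?_
    have hG' : 0 < Real.Gamma (β * j + β) := Real.Gamma_pos_of_pos (by positivity)
    have e : Real.Gamma (β * (j + 1 : ℕ) + 1) = β * (j + 1) * Real.Gamma (β * j + β) := by
      push_cast
      rw [Real.Gamma_add_one (by positivity), mul_add, mul_one]
    rw [e]
    push_cast
    field_simp
  · have hG : 0 < Real.Gamma (β * j + β) := Real.Gamma_pos_of_pos (by positivity)
    have ht0 : 0 < t := by linarith [ht.1]
    rw [norm_mul, norm_div, norm_pow, norm_mul, norm_mul, Real.norm_eq_abs,
      Real.norm_of_nonneg hG.le, Real.norm_of_nonneg (Real.rpow_nonneg ht0.le _),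
      Real.norm_of_nonneg (Real.rpow_nonneg ht0.le _)]
    have h1 : t ^ (β - 1) ≤ (s / 2) ^ (β - 1) :=
      Real.rpow_le_rpow_of_nonpos (by positivity) ht.1.le (by linarith)
    have h2 : t ^ β ≤ (s + 1) ^ β := Real.rpow_le_rpow ht0.le ht.2.le hβ.le
    gcongr
  · exact (summable_nat_add_iff 1).2 (summable_mittagLeffler hβ (b * s ^ β))

/-- By the Beta integral, the Caputo integral of the `j`-th derivative term is `Gamma (1 - β) * b`
times the `j`-th term of the series. Replacing `b` by `|b|` gives the norms, which are summable, so
sum and integral commute. -/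
theorem caputo_relaxation {β b T : ℝ} (hβ : 0 < β) (hβ' : β < 1) (hT : 0 < T) :
    IntegrableOn (fun s => (T - s) ^ (-β) * deriv (relaxation β b) s) (Ioc 0 T) ∧
    ∫ s in Ioc 0 T, (T - s) ^ (-β) * deriv (relaxation β b) s =
      Real.Gamma (1 - β) * (b * relaxation β b T) := by
  have hu : 0 < 1 - β := sub_pos.2 hβ'
  have hGu : 0 < Real.Gamma (1 - β) := Real.Gamma_pos_of_pos hu
  have hG : ∀ j : ℕ, 0 < Real.Gamma (β * j + β) := fun j => Real.Gamma_pos_of_pos (by positivity)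
  let f : ℝ → ℕ → ℝ → ℝ := fun c j s =>
    (T - s) ^ (-β) * ((c * s ^ β) ^ j / Real.Gamma (β * j + β) * (c * s ^ (β - 1)))
  have hf : ∀ c j s, f c j s = c / Real.Gamma (β * j + β) *
      ((T - s) ^ (1 - β - 1) * ((c * s ^ β) ^ j * s ^ (β - 1))) := fun c j s => by
    simp only [f, show 1 - β - 1 = -β by ring]; ring
  have hint : ∀ c j, IntegrableOn (f c j) (Ioc 0 T) := fun c j => by
    refine (((intervalIntegrable_iff_integrableOn_Ioc_of_le hT.le).1
      (intervalIntegrable_abel_pow hβ hu hβ hT c j)).const_mul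
        (c / Real.Gamma (β * j + β))).congr (Eventually.of_forall fun s => (hf c j s).symm)
  have hval : ∀ c j, ∫ s in Ioc 0 T, f c j s =
      Real.Gamma (1 - β) * (c * ((c * T ^ β) ^ j / Real.Gamma (β * j + 1))) := fun c j => by
    simp only [hf]
    rw [integral_const_mul, ← intervalIntegral.integral_of_le hT.le,
      integral_abel_pow hβ hu hβ hT c j]
    have := hG j
    simp only [sub_add_cancel, sub_self, Real.rpow_zero]
    field_simp
  have hnorm : ∀ j, ∀ s ∈ Ioc 0 T, ‖f b j s‖ = f |b| j s := fun j s hs => by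
    simp only [f, norm_mul, norm_div, norm_pow, Real.norm_eq_abs, abs_of_pos (hG j),
      abs_of_nonneg (Real.rpow_nonneg hs.1.le _),
      abs_of_nonneg (Real.rpow_nonneg (sub_nonneg.2 hs.2) _)]
  have hsum : Summable fun j => ∫ s in Ioc 0 T, ‖f b j s‖ := by
    have e : ∀ j, ∫ s in Ioc 0 T, ‖f b j s‖ =
        Real.Gamma (1 - β) * (|b| * ((|b| * T ^ β) ^ j / Real.Gamma (β * j + 1))) := fun j => by
      rw [← hval]
      exact setIntegral_congr_fun measurableSet_Ioc (hnorm j)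
    simp only [e]
    exact ((summable_mittagLeffler hβ _).mul_left _).mul_left _
  have htsum : ∀ s, ∑' j, f b j s = (T - s) ^ (-β) * relaxationDeriv β b s := fun s => by
    simp only [f, relaxationDeriv, tsum_mul_left]
  have hder : ∀ s ∈ Ioc 0 T, deriv (relaxation β b) s = relaxationDeriv β b s :=
    fun s hs => (hasDerivAt_relaxation hβ hβ' hs.1).deriv
  constructor
  -- On `(0, T]` the series factor is at most its value `K` at `|b| * T ^ β`, so an Abel kernel
  -- dominates.
  · have hK := (summable_mittagLeffler_deriv hβ (|b| * T ^ β)).hasSum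
    set K := ∑' j : ℕ, (|b| * T ^ β) ^ j / Real.Gamma (β * j + β) with hKdef
    have hker := (intervalIntegrable_iff_integrableOn_Ioc_of_le hT.le).1
      (intervalIntegrable_abel_kernel hu hβ hT)
    refine (hker.const_mul (K * |b|)).mono' ((measurable_const.sub measurable_id).pow_const _ |>.mul
      (measurable_deriv _)).aestronglyMeasurable ?_
    refine (ae_restrict_iff' measurableSet_Ioc).2 (Eventually.of_forall fun s hs => ?_)
    have h1 := Real.rpow_nonneg (sub_nonneg.2 hs.2) (-β)
    have h2 := Real.rpow_nonneg hs.1.le (β - 1)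
    have h3 : ‖∑' j : ℕ, (b * s ^ β) ^ j / Real.Gamma (β * j + β)‖ ≤ K := by
      refine tsum_of_norm_bounded hK fun j => ?_
      have := hG j
      have := Real.rpow_nonneg hs.1.le β
      have := Real.rpow_le_rpow hs.1.le hs.2 hβ.le
      rw [norm_div, norm_pow, norm_mul, Real.norm_eq_abs, Real.norm_of_nonneg (hG j).le,
        Real.norm_of_nonneg (Real.rpow_nonneg hs.1.le _)]
      gcongr
    rw [hder s hs, relaxationDeriv, tsum_mul_right, norm_mul, norm_mul, norm_mul,
      Real.norm_of_nonneg h1, Real.norm_of_nonneg h2, Real.norm_eq_abs b, sub_zero,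
      show 1 - β - 1 = -β by ring]
    calc _ ≤ (T - s) ^ (-β) * (K * (|b| * s ^ (β - 1))) := by gcongr
      _ = _ := by ring
  · have h := integral_tsum_of_summable_integral_norm (hint b) hsum
    simp only [htsum, hval] at h
    rw [setIntegral_congr_fun (g := fun s => (T - s) ^ (-β) * relaxationDeriv β b s)
      measurableSet_Ioc fun s hs => by simp only [hder s hs], ← h, tsum_mul_left, tsum_mul_left,
      relaxation]

/-! ### Price paths in the staircase coordinate -/

theorem isClosed_pointsOfChange (f : ℝ → ℝ) : IsClosed (pointsOfChange f) := by
  rw [← isOpen_compl_iff, isOpen_iff_mem_nhds]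
  intro x hx
  simp only [pointsOfChange, mem_compl_iff, mem_ofPred_eq, not_forall] at hx
  obtain ⟨c, d, hc, hd, h⟩ := hx
  filter_upwards [Ioo_mem_nhds hc hd] with y hy hy'
  exact h (hy' c d hy.1 hy.2)

theorem eventually_eq_of_notMem_pointsOfChange {f : ℝ → ℝ} {x : ℝ} (hx : x ∉ pointsOfChange f) :
    ∀ᶠ y in 𝓝 x, f y = f x := by
  simp only [pointsOfChange, mem_ofPred_eq, not_forall] at hx
  obtain ⟨c, d, hc, hd, h⟩ := hx
  filter_upwards [Ioo_mem_nhds hc hd] with y hy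
  by_contra hne
  exact h ⟨y, hy, x, ⟨hc, hd⟩, hne⟩

/-- `lastTime S` itself may jump. But `S` maps the compact `[0, b]` continuously onto `[0, S b]`,
hence is a quotient map, and the composite with `S` is the continuous function `p`. -/
theorem IsClock.continuousOn_comp_lastTime {S : ℝ → ℝ} (hS : IsClock S) {p : ℝ → ℝ}
    (hp : ContinuousOn p (Ici 0)) (hpS : ∀ t, 0 ≤ t → p (lastTime S (S t)) = p t) :
    ContinuousOn (fun s => p (lastTime S s)) (Ici 0) := by
  intro s hs
  have hs : 0 ≤ s := hs
  obtain ⟨b, hsb, hb⟩ := ((hS.top.eventually_gt_atTop s).and (eventually_ge_atTop 0)).exists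
  have hmaps : MapsTo S (Icc 0 b) (Icc 0 (S b)) := fun t ht => ⟨hS.nonneg ht.1, hS.mono ht.2⟩
  have hcont : Continuous (hmaps.restrict S _ _) := hS.cont.continuousOn.mapsToRestrict hmaps
  have hsurj : Function.Surjective (hmaps.restrict S _ _) := by
    rintro ⟨r, hr⟩
    obtain ⟨t, ht, h⟩ := intermediate_value_Icc hb hS.cont.continuousOn
      (show r ∈ Icc (S 0) (S b) by rwa [hS.zero])
    exact ⟨⟨t, ht⟩, Subtype.ext h⟩
  have hquot := hcont.isClosedMap.isQuotientMap hcont hsurj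
  have h : ContinuousOn (fun s => p (lastTime S s)) (Icc 0 (S b)) := by
    rw [continuousOn_iff_continuous_domRestrict, hquot.continuous_iff]
    refine (continuousOn_iff_continuous_domRestrict.1
      (hp.mono fun t (ht : t ∈ Icc 0 b) => ht.1)).congr fun t => ?_
    exact (hpS t t.2.1).symm
  refine (h s ⟨hs, hsb.le⟩).mono_of_mem_nhdsWithin ?_
  filter_upwards [self_mem_nhdsWithin, mem_nhdsWithin_of_mem_nhds (Iio_mem_nhds hsb)]
    with t h1 h2 using ⟨h1, le_of_lt h2⟩

theorem fractalDeriv_eq (hS : IsClock (staircase F α)) (hF : pointsOfChange (staircase F α) = F)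
    {p : ℝ → ℝ} {x l : ℝ} (hx : x ∈ F) (hpos : 0 < staircase F α x)
    (h : Tendsto (fractalSlope F α p x) (𝓝[F \ {x}] x) (𝓝 l)) : fractalDeriv F α p x = l := by
  have := hS.nhdsWithin_neBot (by rwa [hF]) hpos
  rw [hF] at this
  rw [fractalDeriv, if_pos hx, h.limUnder_eq]

/-- Between `t` and the last time of its level `S` is flat, so there is no point of `F`; there `p`
has derivative zero, and the mean value theorem applies. -/
theorem IsPricePath.apply_lastTime (hS : IsClock (staircase F α))
    (hF : pointsOfChange (staircase F α) = F) {p : ℝ → ℝ} (hp : IsPricePath F α p) {t : ℝ}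
    (ht : 0 ≤ t) : p (lastTime (staircase F α) (staircase F α t)) = p t := by
  set u := lastTime (staircase F α) (staircase F α t) with hu
  rcases (hS.le_lastTime_apply (t := t)).eq_or_lt with h | h
  · rw [hu, ← h]
  have hSu : staircase F α t = staircase F α u :=
    (hS.apply_lastTime_of_nonneg (hS.nonneg ht)).symm
  obtain ⟨c, -, hc⟩ := exists_hasDerivAt_eq_slope p (fun _ => 0) h
    (hp.continuousOn.mono fun x hx => ht.trans hx.1) fun x hx => by
      have hxF : x ∉ F := hF ▸ hS.notMem_pointsOfChange hSu hx.1 hx.2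
      exact (hasDerivAt_const x (p x)).congr_of_eventuallyEq
        (hp.locallyConstant x (ht.trans_lt hx.1) hxF)
  have hne : u - t ≠ 0 := (sub_pos.2 h).ne'
  rw [eq_comm, div_eq_zero_iff, or_iff_left hne, sub_eq_zero] at hc
  exact hc

/-- Where `lastTime` is continuous, it tends to its value through other points of `F`, being
injective on positive levels. The ordinary slope of the composite is then the fractal slope of `p`.
-/
theorem hasDerivAt_comp_lastTime (hS : IsClock (staircase F α))
    (hF : pointsOfChange (staircase F α) = F) {p : ℝ → ℝ} (hp : IsPricePath F α p) {s : ℝ}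
    (hs : 0 < s) (hc : ContinuousAt (lastTime (staircase F α)) s) :
    HasDerivAt (fun s => p (lastTime (staircase F α) s))
      (fractalDeriv F α p (lastTime (staircase F α) s)) s := by
  set S := staircase F α with hSdef
  have hmem : ∀ s, lastTime S s ∈ F := fun s => hF ▸ hS.lastTime_mem_pointsOfChange s
  have hSs := hS.apply_lastTime_of_nonneg hs.le
  obtain ⟨l, hl⟩ := hp.differentiable (lastTime S s) (hmem s) (by rwa [← hSdef, hSs])
  rw [fractalDeriv_eq hS hF (hmem s) (by rwa [← hSdef, hSs]) hl, hasDerivAt_iff_tendsto_slope]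
  have hev : ∀ᶠ r in 𝓝[≠] s, 0 < r := mem_nhdsWithin_of_mem_nhds (Ioi_mem_nhds hs)
  have ht : Tendsto (lastTime S) (𝓝[≠] s) (𝓝[F \ {lastTime S s}] (lastTime S s)) := by
    refine tendsto_nhdsWithin_iff.2 ⟨hc.tendsto.mono_left nhdsWithin_le_nhds, ?_⟩
    filter_upwards [hev, self_mem_nhdsWithin] with r hr hne
    refine ⟨hmem r, fun h => hne ?_⟩
    have := hS.apply_lastTime_of_nonneg hr.le
    rw [mem_singleton_iff.1 h, hSs] at this
    exact this.symm
  refine (hl.comp ht).congr' ?_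
  filter_upwards [hev] with r hr
  rw [slope_def_field, Function.comp_apply, fractalSlope, ← hSdef, hSs,
    hS.apply_lastTime_of_nonneg hr.le]

theorem SolvesCaputo.eq_relaxation (hS : IsClock (staircase F α))
    (hF : pointsOfChange (staircase F α) = F) {β a k p₀ : ℝ} (hβ : 0 < β) (hβ' : β < 1)
    {p : ℝ → ℝ} (hp : SolvesCaputo F α β a (a * k) p₀ p) {t : ℝ} (ht : 0 ≤ t) :
    p t = k + (p₀ - k) * relaxation β (-a) (staircase F α t) := by
  set S := staircase F α with hSdef
  have hpS := fun t ht => hp.path.apply_lastTime hS hF (t := t) ht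
  let h : ℝ → ℝ := fun s => p (lastTime S s) - k
  have hd : ∀ s, 0 < s → ContinuousAt (lastTime S) s →
      HasDerivAt h (fractalDeriv F α p (lastTime S s)) s := fun s hs hc =>
    (hasDerivAt_comp_lastTime hS hF hp.path hs hc).sub_const k
  have hC := hS.lastTime_mono.countable_not_continuousAt
  have hpos : ∀ T, 0 < T → 0 < S (lastTime S T) := fun T hT => by
    rwa [hS.apply_lastTime_of_nonneg hT.le]
  -- The jumps of the monotone `lastTime S` form a countable, hence null, set. Passing to `deriv h`
  -- also provides measurability.
  have hcongr : ∀ T, (fun s => caputoIntegrand F α β p (lastTime S T) (lastTime S s))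
      =ᵐ[volume.restrict (Ioc 0 T)] fun s => (T - s) ^ (-β) * deriv h s := fun T => by
    filter_upwards [ae_restrict_mem measurableSet_Ioc, ae_restrict_of_ae (hC.ae_notMem volume)]
      with s hs hc
    rw [(hd s hs.1 (not_not.1 hc)).deriv, caputoIntegrand, ← hSdef,
      hS.apply_lastTime_of_nonneg (hs.1.le.trans hs.2), hS.apply_lastTime_of_nonneg hs.1.le]
  have hint : ∀ T, 0 < T → IntegrableOn (fun s => (T - s) ^ (-β) * deriv h s) (Ioc 0 T) :=
    fun T hT => by
      have hi := hp.exists_deriv _ (hpos T hT)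
      have := (integrableOn_fractalMeasure_Ioc hS hi.aestronglyMeasurable).1 hi
      rw [← hSdef, hS.apply_lastTime_of_nonneg hT.le] at this
      exact this.congr (hcongr T)
  have heq : ∀ T, 0 < T → 1 / Real.Gamma (1 - β) *
      ∫ s in Ioc 0 T, (T - s) ^ (-β) * deriv h s = -a * h T := fun T hT => by
    have hi := hp.exists_deriv _ (hpos T hT)
    have he := hp.equation _ (hpos T hT)
    rw [caputoDeriv, fractalGamma_eq hS (sub_pos.2 hβ'),
      integral_fractalMeasure_Ioc hS hi.aestronglyMeasurable, ← hSdef,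
      hS.apply_lastTime_of_nonneg hT.le, integral_congr_ae (hcongr T)] at he
    simp only [h]
    linear_combination he
  have hcont : ContinuousOn h (Ici 0) :=
    (hS.continuousOn_comp_lastTime hp.path.continuousOn hpS).sub continuousOn_const
  have hmain := eq_relaxation_of_caputo hβ hβ' hC hcont
    (fun s hs hc => by
      have := hd s hs (not_not.1 hc)
      exact this.differentiableAt.hasDerivAt) hint heq (hS.nonneg ht)
  have h0 : h 0 = p₀ - k := by
    have := hpS 0 le_rfl
    rw [← hSdef, hS.zero] at this
    simp only [h]
    rw [this, hp.initial]
  rw [h0] at hmain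
  simp only [h] at hmain
  rw [hpS t ht] at hmain
  linear_combination hmain

theorem tendsto_fractalSlope_comp (hS : IsClock (staircase F α))
    (hF : pointsOfChange (staircase F α) = F) {p G : ℝ → ℝ} {l : ℝ}
    (hp : ∀ t, 0 ≤ t → p t = G (staircase F α t)) {t : ℝ}
    (hpos : 0 < staircase F α t) (hG : HasDerivAt G l (staircase F α t)) :
    Tendsto (fractalSlope F α p t) (𝓝[F \ {t}] t) (𝓝 l) := by
  have ht0 := hS.pos_of_apply_pos hpos
  have hev := hS.eventually_apply_ne t
  rw [hF] at hev
  have ht : Tendsto (staircase F α) (𝓝[F \ {t}] t) (𝓝[≠] (staircase F α t)) :=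
    tendsto_nhdsWithin_iff.2 ⟨hS.cont.continuousAt.tendsto.mono_left nhdsWithin_le_nhds, hev⟩
  refine ((hasDerivAt_iff_tendsto_slope.1 hG).comp ht).congr' ?_
  filter_upwards [mem_nhdsWithin_of_mem_nhds (Ioi_mem_nhds ht0)] with y hy
  rw [Function.comp_apply, slope_def_field, fractalSlope, hp y (le_of_lt hy), hp t ht0.le]

theorem solvesCaputo_relaxation (hS : IsClock (staircase F α))
    (hF : pointsOfChange (staircase F α) = F) {β a k p₀ : ℝ} (hβ : 0 < β) (hβ' : β < 1)
    {p : ℝ → ℝ}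
    (hp : ∀ t, 0 ≤ t → p t = k + (p₀ - k) * relaxation β (-a) (staircase F α t)) :
    SolvesCaputo F α β a (a * k) p₀ p := by
  have hG : ∀ s, 0 < s → HasDerivAt (fun s => k + (p₀ - k) * relaxation β (-a) s)
      ((p₀ - k) * deriv (relaxation β (-a)) s) s := fun s hs =>
    ((hasDerivAt_relaxation hβ hβ' hs).differentiableAt.hasDerivAt.const_mul _).const_add _
  have hslope := fun t (ht : 0 < staircase F α t) =>
    tendsto_fractalSlope_comp hS hF (G := fun s => k + (p₀ - k) * relaxation β (-a) s) hp ht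
      (hG _ ht)
  have hmem : ∀ s, lastTime (staircase F α) s ∈ F := fun s =>
    hF.le (hS.lastTime_mem_pointsOfChange s)
  have hD : ∀ s, 0 < s → fractalDeriv F α p (lastTime (staircase F α) s) =
      (p₀ - k) * deriv (relaxation β (-a)) s := fun s hs => by
    have hSs := hS.apply_lastTime_of_nonneg hs.le
    rw [fractalDeriv_eq hS hF (hmem s) (by rwa [hSs]) (hslope _ (by rwa [hSs])), hSs]
  -- The measure on `(0, t]` is carried by the points of `F` with `S > 0`, where the fractal
  -- derivative is a measurable function of `S`.
  have hmeas : ∀ t, AEStronglyMeasurable (caputoIntegrand F α β p t)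
      ((fractalMeasure F α).restrict (Ioc 0 t)) := fun t => by
    have hm := hS.mono.measurable
    have hm' := measurable_deriv (relaxation β (-a))
    refine AEStronglyMeasurable.congr (f := fun r => (staircase F α t - staircase F α r) ^ (-β) *
      ((p₀ - k) * deriv (relaxation β (-a)) (staircase F α r)))
      (Measurable.aestronglyMeasurable (by fun_prop)) ?_
    have hFm : MeasurableSet F := hF ▸ (isClosed_pointsOfChange _).measurableSet
    have hae := ae_fractalMeasure_Ioc hS (x := t) (p := fun r => r ∈ F ∧ 0 < staircase F α r)
      (hFm.inter (measurableSet_lt measurable_const hm))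
      fun s hs => ⟨hmem s, by rw [hS.apply_lastTime_of_nonneg hs.1.le]; exact hs.1⟩
    filter_upwards [hae] with r hr
    rw [caputoIntegrand, fractalDeriv_eq hS hF hr.1 hr.2 (hslope r hr.2)]
  have hcongr : ∀ t, ∀ s ∈ Ioc 0 (staircase F α t),
      caputoIntegrand F α β p t (lastTime (staircase F α) s) =
        (p₀ - k) * ((staircase F α t - s) ^ (-β) * deriv (relaxation β (-a)) s) := fun t s hs => by
    rw [caputoIntegrand, hD s hs.1, hS.apply_lastTime_of_nonneg hs.1.le]
    ring
  refine ⟨⟨?_, ?_, ?_⟩, ?_, fun t ht => ?_, fun t ht => ?_⟩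
  · have h := (continuousOn_relaxation hβ (-a)).comp hS.cont.continuousOn
      (fun t (ht : t ∈ Ici 0) => hS.nonneg ht)
    exact (continuousOn_const.add (continuousOn_const.mul h)).congr hp
  · intro t ht htF
    rw [← hF] at htF
    filter_upwards [eventually_eq_of_notMem_pointsOfChange htF, Ioi_mem_nhds ht] with u hu hu0
    rw [hp u (le_of_lt hu0), hp t ht.le, hu]
  · exact fun t _ ht => ⟨_, hslope t ht⟩
  · rw [hp 0 le_rfl, hS.zero, relaxation_zero hβ]; ring
  · rw [CaputoExistsAt, integrableOn_fractalMeasure_Ioc hS (hmeas t)]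
    exact IntegrableOn.congr_fun ((caputo_relaxation hβ hβ' ht).1.const_mul (p₀ - k))
      (fun s hs => (hcongr t s hs).symm) measurableSet_Ioc
  · have hG1 : Real.Gamma (1 - β) ≠ 0 := (Real.Gamma_pos_of_pos (sub_pos.2 hβ')).ne'
    rw [caputoDeriv, fractalGamma_eq hS (sub_pos.2 hβ'), integral_fractalMeasure_Ioc hS (hmeas t),
      setIntegral_congr_fun measurableSet_Ioc (hcongr t), integral_const_mul,
      (caputo_relaxation hβ hβ' ht).2, hp t (hS.pos_of_apply_pos ht).le]
    field_simp
    ring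

/-! ### The equivalence and its two applications -/

theorem mittagLefflerTerm_eq (hS : IsClock (staircase F α)) {β : ℝ} (hβ : 0 < β) (z : ℝ) :
    mittagLefflerTerm F α β 1 z = fun j : ℕ => z ^ j / Real.Gamma (β * j + 1) := by
  ext j
  rw [mittagLefflerTerm, fractalGamma_eq hS (by positivity)]

theorem solvesCaputo_iff (hS : IsClock (staircase F α))
    (hF : pointsOfChange (staircase F α) = F) {β a k p₀ : ℝ} (hβ : 0 < β) (hβ' : β < 1)
    {p : ℝ → ℝ} : SolvesCaputo F α β a (a * k) p₀ p ↔ ∀ t : ℝ, 0 ≤ t →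
      p t = p₀ * fractalMittagLeffler F α β 1 (-a * staircase F α t ^ β) +
        k * (1 - fractalMittagLeffler F α β 1 (-a * staircase F α t ^ β)) := by
  have e : ∀ t, p₀ * fractalMittagLeffler F α β 1 (-a * staircase F α t ^ β) +
      k * (1 - fractalMittagLeffler F α β 1 (-a * staircase F α t ^ β)) =
      k + (p₀ - k) * relaxation β (-a) (staircase F α t) := fun t => by
    rw [fractalMittagLeffler, mittagLefflerTerm_eq hS hβ, relaxation]
    ring
  simp only [e]
  exact ⟨fun h t ht => h.eq_relaxation hS hF hβ hβ' ht, solvesCaputo_relaxation hS hF hβ hβ'⟩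

end FractalCalculus

end

open FractalCalculus in
theorem mainTheorem7 (F : Set ℝ) (α β : ℝ) (hα : 0 < α) (hα' : α ≤ 1) (hβ : 0 < β) (hβ' : β < 1)
    (hF : IsAlphaPerfect F α) (hS : Tendsto (staircase F α) atTop atTop)
    (d₀ d₁ s₀ s₁ : ℝ) (h₁ : d₁ + s₁ ≠ 0) :
    (∀ z : ℝ, Summable (mittagLefflerTerm F α β 1 z)) ∧
    (∀ (lam p₀ : ℝ) (p : ℝ → ℝ),
      SolvesCaputo F α β (lam * (d₁ + s₁)) (lam * (d₀ + s₀)) p₀ p ↔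
        ∀ t : ℝ, 0 ≤ t →
          p t = p₀ * fractalMittagLeffler F α β 1 (-(lam * (d₁ + s₁)) * staircase F α t ^ β) +
            (d₀ + s₀) / (d₁ + s₁) *
              (1 - fractalMittagLeffler F α β 1
                (-(lam * (d₁ + s₁)) * staircase F α t ^ β))) ∧
    (∀ (d₂ s₂ : ℝ), d₂ + s₂ ≠ 0 → ∀ (p₀ : ℝ) (p : ℝ → ℝ),
      SolvesCaputo F α β (-((d₁ + s₁) / (d₂ + s₂))) (-((d₀ + s₀) / (d₂ + s₂))) p₀ p ↔
        ∀ t : ℝ, 0 ≤ t →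
          p t = p₀ * fractalMittagLeffler F α β 1
              ((d₁ + s₁) / (d₂ + s₂) * staircase F α t ^ β) +
            (d₀ + s₀) / (d₁ + s₁) *
              (1 - fractalMittagLeffler F α β 1
                ((d₁ + s₁) / (d₂ + s₂) * staircase F α t ^ β))) := by
  have hclock := hF.isClock hα hS
  have hF' := hF.pointsOfChange_eq
  refine ⟨fun z => ?_, fun lam p₀ p => ?_, fun d₂ s₂ h₂ p₀ p => ?_⟩
  · rw [mittagLefflerTerm_eq hclock hβ]
    exact summable_mittagLeffler hβ z
  -- The constant side is the coefficient times the equilibrium `(d₀ + s₀) / (d₁ + s₁)`; not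
  -- dividing by `lam` keeps `lam = 0` covered.
  · have e : lam * (d₀ + s₀) = lam * (d₁ + s₁) * ((d₀ + s₀) / (d₁ + s₁)) := by field_simp
    rw [e]
    exact solvesCaputo_iff hclock hF' hβ hβ'
  · have e : -((d₀ + s₀) / (d₂ + s₂)) =
        -((d₁ + s₁) / (d₂ + s₂)) * ((d₀ + s₀) / (d₁ + s₁)) := by field_simp
    rw [e]
    have h := solvesCaputo_iff hclock hF' (a := -((d₁ + s₁) / (d₂ + s₂)))
      (k := (d₀ + s₀) / (d₁ + s₁)) (p₀ := p₀) hβ hβ' (p := p)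
    rwa [neg_neg] at h
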